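/- Let $q$ be an odd prime power, $q^\times := q-1$, let $\psi:\mathbb{F}_q\to\mathbb{C}^\times$ be a non-trivial additive character and $\chi:\mathbb{F}_q^\times\to\mathbb{C}^\times$ a multiplicative character of order $q^\times$. For $m\in\mathbb{Z}$ put $g(m)=\sum_{x\in\mathbb{F}_q^\times}\psi(x)\chi^m(x)$. Let $t\in\mathbb{F}_q^\times$. For $\alpha,\beta\in\mathbb{Q}^n$, with $\alpha_i-\beta_j\notin\mathbb{Z}$ for all $i,j$ and $q^\times\alpha,q^\times\beta\in\mathbb{Z}^n$, put $$F_q(\alpha;\beta\mid t)=\frac{1}{1-q}\sum_{m=0}^{q-2}\ \prod_{i=1}^n\frac{g(m+\alpha_iq^\times)\,g(-m-\beta_iq^\times)}{g(\alpha_iq^\times)\,g(-\beta_iq^\times)}\ \chi\big((-1)^nt\big)^m .$$ If $q^\times\alpha,q^\times\beta$ are not both integral, but there are an integer $k$ and a vector $\gamma\in(\mathbb{Z}\setminus\{0\})^k$ with all entries prime to $q$ and $$\frac{\prod_{j}(T-e^{2\pi i\alpha_j})}{\prod_{j}(T-e^{2\pi i\beta_j})}=\frac{\prod_{\gamma_j<0}(T^{-\gamma_j}-1)}{\prod_{\gamma_j>0}(T^{\gamma_j}-1)},\qquad(\ast)$$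 then $F_q(\alpha;\beta\mid t)$ denotes $$\frac{(-1)^k}{1-q}\sum_{m=0}^{q-2}\ \prod_{j=1}^kg(-\gamma_jm)\ q^{s(m)-s(0)}\,\chi^m(\gamma^\gamma t),\qquad \gamma^\gamma=\prod_{j=1}^k\gamma_j^{\gamma_j},$$ where $s(m)$ is the multiplicity of the zero $e^{2\pi im/q^\times}$ in the greatest common divisor of the numerator and the denominator of the right-hand side of $(\ast)$; the formula below holds for every such choice of $\gamma$ for each of the parameters involved. **Theorem.** Let $u\in\mathbb{F}_q^\times$ and let $X_u\subset\mathbb{P}^3$ be the quartic surface $$y_1^4+y_2^4+y_3^4+y_4^4-4u^{-1}y_1y_2y_3y_4=0$$ over $\mathbb{F}_q$. (1) If $q\equiv3\pmod 4$, then $$\#X_u(\mathbb{F}_q)=q^2+q+1+F_q\big(\tfrac14,\tfrac24,\tfrac34;\,1,1,1\mid u^4\big)-3q\,F_q\big(\tfrac14,\tfrac34;\,\tfrac12,1\mid u^4\big).$$ (2) If $q\equiv1\pmod 4$, then $$\#X_u(\mathbb{F}_q)=q^2+q+1+F_q\big(\tfrac14,\tfrac24,\tfrac34;\,1,1,1\mid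 u^4\big)+3q\,F_q\big(\tfrac14,\tfrac34;\,\tfrac12,1\mid u^4\big)+12\,\chi(-1)^{q^\times/4}\,q\,F_q\big(\tfrac12;\,1\mid u^4\big).$$ -/

import Mathlib

open scoped LinearAlgebra.Projectivization

noncomputable section

/-- The Gauss sum `g(m) = ∑_{x ≠ 0} ψ(x) χ^m(x)` for `m : ℤ`.
(A `MulChar`, also the trivial one, vanishes at `0`, so `x = 0` does not contribute.) -/
def gaussG {F : Type*} [Field F] [Fintype F] (ψ : AddChar F ℂ) (χ : MulChar F ℂ) (m : ℤ) : ℂ :=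
  gaussSum (χ ^ m) ψ

/-- The finite hypergeometric sum attached to parameters `α, β ∈ ℚⁿ` such that
`(q - 1) α` and `(q - 1) β` are integral:
`1/(1-q) ∑_m ∏_i g(m + α_i(q-1)) g(-m - β_i(q-1)) / (g(α_i(q-1)) g(-β_i(q-1))) χ((-1)ⁿ t)^m`.
Under the integrality condition `⌊(q - 1) α_i⌋` is `(q - 1) α_i` itself; the definition is only
used under that condition. -/
def hypergeometricSum {F : Type*} [Field F] [Fintype F] (ψ : AddChar F ℂ) (χ : MulChar F ℂ)
    {n : ℕ} (α β : Fin n → ℚ) (t : F) : ℂ :=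
  1 / (1 - (Fintype.card F : ℂ)) *
    ∑ m ∈ Finset.range (Fintype.card F - 1),
      (∏ i : Fin n,
        gaussG ψ χ ((m : ℤ) + ⌊((Fintype.card F : ℚ) - 1) * α i⌋) *
            gaussG ψ χ (-(m : ℤ) - ⌊((Fintype.card F : ℚ) - 1) * β i⌋) /
          (gaussG ψ χ ⌊((Fintype.card F : ℚ) - 1) * α i⌋ *
            gaussG ψ χ (-⌊((Fintype.card F : ℚ) - 1) * β i⌋))) *
        χ ((-1) ^ n * t) ^ m

/-- `∏_{γ_j < 0} (T^{-γ_j} - 1)`. -/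
def gammaNum {k : ℕ} (γ : Fin k → ℤ) : Polynomial ℂ :=
  ∏ j with γ j < 0, (Polynomial.X ^ (γ j).natAbs - 1)

/-- `∏_{γ_j > 0} (T^{γ_j} - 1)`. -/
def gammaDen {k : ℕ} (γ : Fin k → ℤ) : Polynomial ℂ :=
  ∏ j with 0 < γ j, (Polynomial.X ^ (γ j).natAbs - 1)

/-- `∏_j (T - e^{2πi α_j})`. -/
def paramPoly {n : ℕ} (α : Fin n → ℚ) : Polynomial ℂ :=
  ∏ j, (Polynomial.X - Polynomial.C (Complex.exp (2 * Real.pi * Complex.I * (α j : ℂ))))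

/-- The vector `γ` of nonzero integers represents the parameters `(α; β)`:
`∏ (T - e^{2πi α_j}) / ∏ (T - e^{2πi β_j}) = ∏_{γ_j < 0} (T^{-γ_j} - 1) / ∏_{γ_j > 0} (T^{γ_j} - 1)`,
written without denominators (which are nonzero polynomials). -/
def GammaRepresents {k n : ℕ} (γ : Fin k → ℤ) (α β : Fin n → ℚ) : Prop :=
  (∀ j, γ j ≠ 0) ∧ paramPoly α * gammaDen γ = paramPoly β * gammaNum γ

open Classical in
/-- `s(m)`: the multiplicity of the zero `e^{2πi m/(q-1)}` in the greatest common divisor of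
`∏_{γ_j < 0} (T^{-γ_j} - 1)` and `∏_{γ_j > 0} (T^{γ_j} - 1)`. -/
def gammaMult (q : ℕ) {k : ℕ} (γ : Fin k → ℤ) (m : ℤ) : ℕ :=
  (EuclideanDomain.gcd (gammaNum γ) (gammaDen γ)).rootMultiplicity
    (Complex.exp (2 * Real.pi * Complex.I * (m : ℂ) / ((q : ℂ) - 1)))

/-- The finite hypergeometric sum attached to a vector `γ` of `k` nonzero integers prime to `q`:
`(-1)^k/(1-q) ∑_m ∏_j g(-γ_j m) q^{s(m) - s(0)} χ^m(γ^γ t)`, where `γ^γ = ∏_j γ_j^{γ_j}`.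
If `γ` represents `(α; β)`, this is the extension of the hypergeometric sum of `(α; β)`
to all `q` prime to the `γ_j`. -/
def gammaHypergeometricSum {F : Type*} [Field F] [Fintype F] (ψ : AddChar F ℂ)
    (χ : MulChar F ℂ) {k : ℕ} (γ : Fin k → ℤ) (t : F) : ℂ :=
  (-1) ^ k / (1 - (Fintype.card F : ℂ)) *
    ∑ m ∈ Finset.range (Fintype.card F - 1),
      (∏ j : Fin k, gaussG ψ χ (-γ j * (m : ℤ))) *
        (Fintype.card F : ℂ) ^
          ((gammaMult (Fintype.card F) γ m : ℤ) - (gammaMult (Fintype.card F) γ 0 : ℤ)) *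
        χ ((∏ j : Fin k, (γ j : F) ^ γ j) * t) ^ m

/-- The quartic form `y₁⁴ + y₂⁴ + y₃⁴ + y₄⁴ - 4 u⁻¹ y₁ y₂ y₃ y₄`. -/
def dworkQuartic {F : Type*} [Field F] (u : F) : MvPolynomial (Fin 4) F :=
  ∑ i, MvPolynomial.X i ^ 4 - MvPolynomial.C (4 * u⁻¹) * ∏ i, MvPolynomial.X i

/-- The `F`-points of the quartic surface `X_u` in `ℙ³`. The vanishing of a form does not depend
on the representative of the point. -/
def dworkPoints {F : Type*} [Field F] (u : F) : Set (ℙ F (Fin 4 → F)) :=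
  {P | MvPolynomial.eval P.rep (dworkQuartic u) = 0}

theorem exp_quarter :
    Complex.exp (2 * Real.pi * Complex.I * (((1 / 4 : ℚ)) : ℂ)) = Complex.I := by
  have h : (2 * Real.pi * Complex.I * (((1 / 4 : ℚ)) : ℂ)) = Real.pi / 2 * Complex.I := by
    push_cast
    ring
  rw [h, Complex.exp_pi_div_two_mul_I]

theorem exp_half :
    Complex.exp (2 * Real.pi * Complex.I * (((1 / 2 : ℚ)) : ℂ)) = -1 := by
  rw [← Complex.exp_pi_mul_I]
  congr 1
  push_cast
  ring

theorem exp_three_quarters :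
    Complex.exp (2 * Real.pi * Complex.I * (((3 / 4 : ℚ)) : ℂ)) = -Complex.I := by
  have h : (2 * Real.pi * Complex.I * (((3 / 4 : ℚ)) : ℂ)) =
      Real.pi * Complex.I + Real.pi / 2 * Complex.I := by
    push_cast
    ring
  rw [h, Complex.exp_add, Complex.exp_pi_mul_I, Complex.exp_pi_div_two_mul_I]
  ring

theorem exp_one :
    Complex.exp (2 * Real.pi * Complex.I * ((1 : ℚ) : ℂ)) = 1 := by
  rw [← Complex.exp_two_pi_mul_I]
  congr 1
  push_cast
  ring

/-- `(-4, 1, 1, 1, 1)` represents `((1/4, 2/4, 3/4); (1, 1, 1))`. -/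
theorem gammaRepresents_quarter_half_threeQuarters :
    GammaRepresents ![-4, 1, 1, 1, 1] ![1 / 4, 2 / 4, 3 / 4] ![1, 1, 1] := by
  have hI : (Polynomial.C Complex.I : Polynomial ℂ) * Polynomial.C Complex.I = -1 := by
    rw [← Polynomial.C_mul, Complex.I_mul_I]; simp
  refine ⟨by decide, ?_⟩
  have h24 : (2 / 4 : ℚ) = 1 / 2 := by norm_num
  simp only [paramPoly, gammaNum, gammaDen, Finset.prod_filter, Fin.prod_univ_succ]
  simp [h24, exp_quarter, exp_half, exp_three_quarters, exp_one,
    -one_div, -Rat.cast_div, -Rat.cast_inv, -Rat.cast_ofNat, -Rat.cast_one]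
  linear_combination (-(Polynomial.X + 1) * (Polynomial.X - 1) ^ 4) * hI

/-- `(-4, 2, 2)` represents `((1/4, 3/4); (1/2, 1))`. -/
theorem gammaRepresents_quarter_threeQuarters :
    GammaRepresents ![-4, 2, 2] ![1 / 4, 3 / 4] ![1 / 2, 1] := by
  have hI : (Polynomial.C Complex.I : Polynomial ℂ) * Polynomial.C Complex.I = -1 := by
    rw [← Polynomial.C_mul, Complex.I_mul_I]; simp
  refine ⟨by decide, ?_⟩
  simp only [paramPoly, gammaNum, gammaDen, Finset.prod_filter, Fin.prod_univ_succ]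
  simp [exp_quarter, exp_half, exp_three_quarters, exp_one,
    -one_div, -Rat.cast_div, -Rat.cast_inv, -Rat.cast_ofNat, -Rat.cast_one]
  linear_combination (-(Polynomial.X ^ 2 - 1) ^ 2) * hI

end

/-!
The number of zeros of the quartic form in `F⁴` is computed by additive characters, and the
exponential of `-4 u⁻¹ z y₁ y₂ y₃ y₄` is expanded in multiplicative characters. Orthogonality leaves
a sum over the quadruples `(θ₁, θ₂, θ₃, θ₄)` of characters with `θ_i⁴ = θ₁ θ₂ θ₃ θ₄` of the products
`∏ g(θ_i) g((∏ θ_j)⁻¹) (∏ θ_j)(-4 u⁻¹)`. The points with a vanishing coordinate only multiply by `q`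
the terms where the product is trivial and some `θ_i` is trivial
(`sum_units_sum_dwork`, `card_mul_ncard_dworkPoints`).

Such a quadruple is `θ` times a quadruple of characters of order dividing four with product `1`, so
the quadruples form classes indexed by the latter up to permutation and shift
(`sum_dworkTerm_of_mod_three`, `sum_dworkTerm_of_mod_one`):

* `(1, 1, 1, 1)`, once, gives `q (q - 1) F(1/4, 2/4, 3/4; 1, 1, 1)`;
* `(1, 1, η, η)` with `η` quadratic, three times, gives `η(-1) q² (q - 1) F(1/4, 3/4; 1/2, 1)`;
* `(1, 1, ι, ι³)` with `ι` of order four, twelve times and only if `q ≡ 1` modulo `4`, gives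
  `ι(-1) q² (q - 1) F(1/2; 1)`.

The second and third identity, and the comparison with Gauss sums at shifted characters if `q ≡ 1`
modulo `4`, rest on the duplication formula of Hasse and Davenport (`gaussSum_duplication`), which
follows from the evaluation `J(φ, φ) = φ⁻¹(4) J(φ, η)` of Jacobi sums. The sign `η(-1)` is
`-1` or `1` according to `q` modulo `4`.

If `q ≡ 3` modulo `4`, the sums are defined through a vector `γ`. The polynomials `Tⁿ - 1` are
multiplicatively independent (`cyclotomicProd_injective`), so `γ` is determined by the parameters up
to pairs `(m, -m)`, and such pairs do not change the sum (`gammaHypergeometricSum_congr`). Hence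
`γ` may be taken to be `(-4, 1, 1, 1, 1)` and `(-4, 2, 2)`, for which the sums are the contributions
above term by term.
-/

noncomputable section

open scoped Classical
open Finset

/-! ### Multiplicative characters and Gauss sums -/

section CharacterSums

variable {F : Type*} [Field F]

theorem MulChar.pow_apply_of_ne_zero (φ : MulChar F ℂ) (n : ℕ) {a : F} (ha : a ≠ 0) :
    (φ ^ n) a = φ a ^ n := MulChar.pow_apply_coe φ n (Units.mk0 a ha)

theorem MulChar.apply_ne_zero_of_ne_zero (φ : MulChar F ℂ) {a : F} (ha : a ≠ 0) : φ a ≠ 0 :=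
  MulChar.apply_ne_zero_iff.2 (isUnit_iff_ne_zero.2 ha)

theorem MulChar.apply_neg_one_sq (φ : MulChar F ℂ) : φ (-1) * φ (-1) = 1 := by
  rw [← map_mul]; simp

theorem four_cast_ne_zero (hF : ringChar F ≠ 2) : (4 : F) ≠ 0 := by
  rw [show (4 : F) = 2 ^ 2 by norm_num]; exact pow_ne_zero 2 (Ring.two_ne_zero hF)

theorem MulChar.apply_neg_four_zpow (φ : MulChar F ℂ) :
    φ (-4) ^ (-4 : ℤ) = (φ 4 ^ 4)⁻¹ := by
  rw [zpow_neg, inv_inj, show φ (-4) = φ (-1) * φ 4 by rw [← map_mul]; congr 1; ring,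
    show (4 : ℤ) = ((4 : ℕ) : ℤ) by rfl, zpow_natCast, mul_pow, show 4 = 2 * 2 by rfl,
    pow_mul (φ (-1)), sq (φ (-1)), φ.apply_neg_one_sq, one_pow, one_mul]

theorem MulChar.apply_div_pow (φ : MulChar F ℂ) (t : F) {a : F} (ha : a ≠ 0) (n : ℕ) :
    φ (t / a ^ n) = φ t * (φ a ^ n)⁻¹ := by
  rw [eq_mul_inv_iff_mul_eq₀ (pow_ne_zero _ (φ.apply_ne_zero_of_ne_zero ha)), ← map_pow,
    ← map_mul, div_mul_cancel₀ _ (pow_ne_zero n ha)]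

variable [Fintype F]

instance : Fintype (MulChar F ℂ) := Fintype.ofFinite _

theorem card_mulChar : Fintype.card (MulChar F ℂ) = Fintype.card Fˣ := by
  rw [← Nat.card_eq_fintype_card, ← Nat.card_eq_fintype_card]
  exact MulChar.card_eq_card_units_of_hasEnoughRootsOfUnity F ℂ

theorem card_units_cast : (Fintype.card Fˣ : ℂ) = (Fintype.card F : ℂ) - 1 := by
  rw [Fintype.card_eq_card_units_add_one (α := F)]; push_cast; ring

theorem card_units_ne_zero : (Fintype.card F : ℂ) - 1 ≠ 0 := by
  rw [← card_units_cast]; exact_mod_cast Fintype.card_ne_zero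

theorem card_field_ne_zero : (Fintype.card F : ℂ) ≠ 0 := by
  exact_mod_cast Fintype.card_ne_zero

theorem sum_units_eq_sum {f : F → ℂ} (hf : f 0 = 0) : ∑ z : Fˣ, f z = ∑ a : F, f a := by
  refine Fintype.sum_of_injective _ Units.val_injective _ _ (fun a ha => ?_) fun _ => rfl
  by_cases h : a = 0
  · exact h ▸ hf
  · exact absurd ⟨Units.mk0 a h, rfl⟩ ha

theorem MulChar.sum_units (φ : MulChar F ℂ) :
    ∑ z : Fˣ, φ z = if φ = 1 then (Fintype.card F : ℂ) - 1 else 0 := by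
  split_ifs with h1
  · subst h1; simp [card_units_cast]
  · rw [sum_units_eq_sum φ.map_zero, MulChar.sum_eq_zero_of_ne_one h1]

theorem MulChar.sum_apply (a : Fˣ) :
    ∑ φ : MulChar F ℂ, φ a = if a = 1 then (Fintype.card F : ℂ) - 1 else 0 := by
  split_ifs with h1
  · subst h1; simp [card_mulChar, card_units_cast]
  · obtain ⟨φ₀, h0⟩ := MulChar.exists_apply_ne_one_of_hasEnoughRootsOfUnity F ℂ (a := (a : F))
      (by simpa using h1)
    have h : φ₀ a * ∑ φ : MulChar F ℂ, φ a = ∑ φ : MulChar F ℂ, φ a := by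
      rw [Finset.mul_sum]
      exact Fintype.sum_equiv (Equiv.mulLeft φ₀) _ _ (fun φ => by simp)
    have h' : (φ₀ a - 1) * ∑ φ : MulChar F ℂ, φ a = 0 := by rw [sub_mul, h]; ring
    exact (mul_eq_zero.1 h').resolve_left (sub_ne_zero.2 h0)

theorem gaussSum_eq_sum_units (φ : MulChar F ℂ) (ψ : AddChar F ℂ) :
    gaussSum φ ψ = ∑ z : Fˣ, φ z * ψ z := by
  rw [gaussSum, sum_units_eq_sum (f := fun a => φ a * ψ a) (by rw [φ.map_zero, zero_mul])]

/-- Fourier inversion on `Fˣ` for the restriction of an additive character. -/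
theorem addChar_fourier (ψ : AddChar F ℂ) (x : Fˣ) :
    ((Fintype.card F : ℂ) - 1) * ψ x = ∑ φ : MulChar F ℂ, φ⁻¹ x * gaussSum φ ψ := by
  simp only [gaussSum_eq_sum_units, Finset.mul_sum]
  rw [Finset.sum_comm]
  have : ∀ z : Fˣ, ∑ φ : MulChar F ℂ, φ⁻¹ x * (φ z * ψ z) =
      if z = x then ((Fintype.card F : ℂ) - 1) * ψ z else 0 := by
    intro z
    have h := MulChar.sum_apply (z * x⁻¹)
    simp only [mul_inv_eq_one] at h
    rw [← ite_zero_mul, ← h, Finset.sum_mul]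
    refine Finset.sum_congr rfl fun φ _ => ?_
    rw [MulChar.inv_apply', Units.val_mul, map_mul, Units.val_inv_eq_inv_val]
    ring
  simp [this]

variable {ψ : AddChar F ℂ}

theorem gaussSum_one_char (hψ : ψ ≠ 1) : gaussSum (1 : MulChar F ℂ) ψ = -1 := by
  exact gaussSum_one_left hψ

theorem gaussSum_inv_addChar (φ : MulChar F ℂ) : gaussSum φ ψ⁻¹ = φ (-1) * gaussSum φ ψ := by
  rw [← mul_gaussSum_inv_eq_gaussSum φ ψ, ← mul_assoc, ← map_mul]; simp

theorem gaussSum_mul_gaussSum_inv (hψ : ψ ≠ 1) {φ : MulChar F ℂ} (hφ : φ ≠ 1) :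
    gaussSum φ ψ * gaussSum φ⁻¹ ψ = φ (-1) * Fintype.card F := by
  have h := gaussSum_mul_gaussSum_eq_card hφ (AddChar.IsPrimitive.of_ne_one hψ)
  have h2 : φ⁻¹ (-1) = φ (-1) := by rw [MulChar.inv_apply']; simp
  rw [gaussSum_inv_addChar, h2] at h
  rw [← h]
  linear_combination (-(gaussSum φ ψ * gaussSum φ⁻¹ ψ)) * φ.apply_neg_one_sq

theorem gaussSum_ne_zero (hψ : ψ ≠ 1) (φ : MulChar F ℂ) : gaussSum φ ψ ≠ 0 := by
  by_cases hφ : φ = 1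
  · rw [hφ, gaussSum_one_char hψ]; norm_num
  · exact gaussSum_ne_zero_of_nontrivial card_field_ne_zero hφ (AddChar.IsPrimitive.of_ne_one hψ)

/-- `∑_y φ(y) ψ(z y⁴)` expanded in Gauss sums. -/
theorem sum_mulChar_mul_addChar_pow_four (φ : MulChar F ℂ) (ψ : AddChar F ℂ) (z : Fˣ) :
    ∑ y : Fˣ, φ y * ψ (z * y ^ 4) =
      ∑ θ : MulChar F ℂ, (if θ ^ 4 = φ then gaussSum θ ψ else 0) * θ⁻¹ z := by
  have hq := card_units_ne_zero (F := F)
  apply mul_left_cancel₀ hq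
  have h1 : ∀ y : Fˣ, ((Fintype.card F : ℂ) - 1) * (φ y * ψ (z * y ^ 4)) =
      ∑ θ : MulChar F ℂ, θ⁻¹ z * gaussSum θ ψ * (φ * (θ ^ 4)⁻¹) y := by
    intro y
    have := addChar_fourier ψ (z * y ^ 4)
    push_cast at this
    rw [mul_left_comm, this, Finset.mul_sum]
    refine Finset.sum_congr rfl fun θ _ => ?_
    rw [map_mul, map_pow, MulChar.mul_apply, ← inv_pow,
      MulChar.pow_apply_of_ne_zero _ _ y.ne_zero]
    ring
  rw [Finset.mul_sum]
  simp only [h1]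
  rw [Finset.sum_comm, Finset.mul_sum]
  refine Finset.sum_congr rfl fun θ _ => ?_
  rw [← Finset.mul_sum, MulChar.sum_units]
  simp only [mul_inv_eq_one, eq_comm (a := φ)]
  split_ifs <;> ring

/-- A complex character of exact order two is the quadratic character. -/
theorem mulChar_eq_quadraticChar {η : MulChar F ℂ} (hη : η ≠ 1)
    (hη2 : η ^ 2 = 1) (t : F) : η t = (quadraticChar F t : ℂ) := by
  by_cases ht : t = 0
  · rw [ht, η.map_zero]; simp
  have hsq : ∀ a : F, a ≠ 0 → η a ^ 2 = 1 := fun a ha => by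
    rw [← MulChar.pow_apply_of_ne_zero _ _ ha, hη2, MulChar.one_apply (isUnit_iff_ne_zero.2 ha)]
  have hs : ∀ a : F, a ≠ 0 → quadraticChar F a = 1 → η a = 1 := fun a ha h => by
    obtain ⟨b, rfl⟩ := (quadraticChar_one_iff_isSquare ha).1 h
    rw [map_mul, ← sq, hsq b (left_ne_zero_of_mul ha)]
  rcases quadraticChar_dichotomy ht with h | h
  · rw [hs t ht h, h]; simp
  · obtain ⟨n, hn⟩ := MulChar.ne_one_iff.1 hη
    have hn1 : η n = -1 := (mul_self_eq_one_iff.1 (by rw [← sq, hsq n n.ne_zero])).resolve_left hn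
    have hqn : quadraticChar F (n : F) = -1 :=
      (quadraticChar_dichotomy n.ne_zero).resolve_left fun h' => hn (hs n n.ne_zero h')
    have := hs (t * n) (mul_ne_zero ht n.ne_zero) (by rw [map_mul, h, hqn]; norm_num)
    rw [map_mul, hn1] at this
    rw [h]; push_cast; linear_combination -this

theorem eq_of_sq_eq_one {φ η : MulChar F ℂ} (hφ : φ ≠ 1) (hφ2 : φ ^ 2 = 1)
    (hη : η ≠ 1) (hη2 : η ^ 2 = 1) : φ = η :=
  MulChar.ext' fun a => by
    rw [mulChar_eq_quadraticChar hφ hφ2, mulChar_eq_quadraticChar hη hη2]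

theorem sum_comp_sq (hF : ringChar F ≠ 2) {η : MulChar F ℂ} (hη : η ≠ 1)
    (hη2 : η ^ 2 = 1) (f : F → ℂ) : ∑ w : F, f (w ^ 2) = ∑ t : F, f t * (1 + η t) := by
  rw [← Finset.sum_fiberwise_of_maps_to (s := univ) (t := univ) (g := fun w : F => w ^ 2)
    (fun _ _ => mem_univ _)]
  refine Finset.sum_congr rfl fun t _ => ?_
  have hc := quadraticChar_card_sqrts (F := F) hF t
  rw [Finset.sum_congr rfl (g := fun _ => f t) (by simp +contextual), Finset.sum_const,
    nsmul_eq_mul, mulChar_eq_quadraticChar hη hη2, mul_comm]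
  congr 1
  rw [add_comm]
  exact_mod_cast (by convert hc using 2; congr 1; ext; simp)

/-- Substituting `x = (w + 1) / 2` turns `x (1 - x)` into `(1 - w²) / 4`; the values `w²` are then
counted by `1 + η`. -/
theorem jacobiSum_self (hF : ringChar F ≠ 2) {φ η : MulChar F ℂ} (hφ : φ ≠ 1) (hη : η ≠ 1)
    (hη2 : η ^ 2 = 1) : jacobiSum φ φ = φ⁻¹ 4 * jacobiSum φ η := by
  have h2 : (2 : F) ≠ 0 := Ring.two_ne_zero hF
  have h4 : (4 : F) = 2 ^ 2 := by norm_num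
  have h4' : (4 : F) ≠ 0 := h4 ▸ pow_ne_zero 2 h2
  have h : jacobiSum φ φ = ∑ w : F, φ⁻¹ 4 * φ (1 - w ^ 2) := by
    rw [jacobiSum]
    refine Fintype.sum_equiv ((Equiv.mulLeft₀ (2 : F) h2).trans (Equiv.subRight 1)) _ _ fun x => ?_
    rw [MulChar.inv_apply', ← map_mul, ← map_mul]
    congr 1
    simp only [Equiv.trans_apply, Equiv.mulLeft₀_apply, Equiv.subRight_apply]
    field_simp
    ring
  rw [h, ← Finset.mul_sum, sum_comp_sq hF hη hη2 (fun t => φ (1 - t))]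
  congr 1
  simp only [mul_add, mul_one, Finset.sum_add_distrib]
  have : ∑ t : F, φ (1 - t) = 0 := by
    rw [← MulChar.sum_eq_zero_of_ne_one hφ]
    exact Fintype.sum_equiv (Equiv.subLeft (1 : F)) _ φ (fun _ => rfl)
  rw [this, zero_add, jacobiSum_comm, jacobiSum]
  simp only [mul_comm]

/-- The quadratic duplication formula of Hasse and Davenport. -/
theorem gaussSum_duplication (hψ : ψ ≠ 1) (hF : ringChar F ≠ 2) {η : MulChar F ℂ} (hη : η ≠ 1)
    (hη2 : η ^ 2 = 1) (φ : MulChar F ℂ) :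
    gaussSum φ ψ * gaussSum (φ * η) ψ = φ⁻¹ 4 * gaussSum (φ ^ 2) ψ * gaussSum η ψ := by
  have h2 : (2 : F) ≠ 0 := Ring.two_ne_zero hF
  have h4 : (4 : F) = 2 ^ 2 := by norm_num
  by_cases h1 : φ = 1
  · subst h1
    rw [inv_one, MulChar.one_apply (isUnit_iff_ne_zero.2 (h4 ▸ pow_ne_zero 2 h2))]
    simp
  by_cases h3 : φ = η
  · subst h3
    rw [← sq, hη2, h4, map_pow, ← MulChar.pow_apply' _ two_ne_zero, inv_pow, hη2, inv_one,
      MulChar.one_apply (isUnit_iff_ne_zero.2 h2)]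
    ring
  have hηη : η * η = 1 := by rw [← sq]; exact hη2
  have hne1 : φ * η ≠ 1 := fun h => h3 (by
    rw [← mul_one φ, ← hηη, ← mul_assoc, h, one_mul])
  have hA := jacobiSum_mul_nontrivial hne1 ψ
  by_cases hsq : φ ^ 2 = 1
  · exact absurd (eq_of_sq_eq_one h1 hsq hη hη2) h3
  have hB := jacobiSum_mul_nontrivial (by rwa [← sq] : φ * φ ≠ 1) ψ
  rw [← sq, jacobiSum_self hF h1 hη hη2] at hB
  apply mul_left_cancel₀ (gaussSum_ne_zero hψ φ)
  linear_combination (-gaussSum (φ * η) ψ) * hB + φ⁻¹ 4 * gaussSum (φ ^ 2) ψ * hA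

end CharacterSums

/-! ### Counting points with quadruples of characters -/

section PointCount

variable {F : Type*} [Field F]

theorem addChar_sum (ψ : AddChar F ℂ) {ι : Type*} (s : Finset ι) (f : ι → F) :
    ψ (∑ i ∈ s, f i) = ∏ i ∈ s, ψ (f i) := by
  induction s using Finset.induction_on with
  | empty => simp
  | insert a s ha ih => rw [Finset.sum_insert ha, Finset.prod_insert ha, AddChar.map_add_eq_mul, ih]

variable [Fintype F]

/-- Orthogonality over the scaling variable `z`: only the tuples of characters with product `φ`
survive. -/
theorem sum_units_mul_sum_pow (a : MulChar F ℂ → ℂ) (φ : MulChar F ℂ) (n : ℕ) :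
    ∑ z : Fˣ, φ z * (∑ θ : MulChar F ℂ, a θ * θ⁻¹ z) ^ n =
      ((Fintype.card F : ℂ) - 1) *
        ∑ Θ : Fin n → MulChar F ℂ, if ∏ i, Θ i = φ then ∏ i, a (Θ i) else 0 := by
  simp only [Fintype.sum_pow, Finset.mul_sum]
  rw [Finset.sum_comm]
  refine Finset.sum_congr rfl fun Θ _ => ?_
  have h : ∀ z : Fˣ, φ z * ∏ i, (a (Θ i) * (Θ i)⁻¹ z) =
      (∏ i, a (Θ i)) * (φ * (∏ i, Θ i)⁻¹) z := by
    intro z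
    have hp : (∏ i, Θ i) (z : F) = ∏ i, Θ i z :=
      map_prod (M := MulChar F ℂ)
        (⟨⟨fun θ => θ z, by simp⟩, fun _ _ => rfl⟩ : MulChar F ℂ →* ℂ) Θ univ
    rw [MulChar.mul_apply, MulChar.inv_apply_eq_inv', hp, Finset.prod_mul_distrib,
      ← Finset.prod_inv_distrib]
    simp only [MulChar.inv_apply_eq_inv']
    ring
  simp only [h]
  rw [← Finset.mul_sum, MulChar.sum_units]
  simp only [mul_inv_eq_one, eq_comm (a := φ)]
  split_ifs <;> ring

variable {ψ : AddChar F ℂ}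

/-- The points with all coordinates nonzero. Fourier expansion of `ψ (-c z ∏ y_i)` separates the
variables, and the sums over `y_i` and `z` force `θ_i⁴ = φ = ∏ θ_j`. -/
theorem sum_units_tuples_dwork (ψ : AddChar F ℂ) (c : Fˣ) :
    ∑ z : Fˣ, ∑ y : Fin 4 → Fˣ, ψ (z * (∑ i, (y i : F) ^ 4 - c * ∏ i, (y i : F))) =
      ∑ Θ : Fin 4 → MulChar F ℂ, if ∀ i, Θ i ^ 4 = ∏ j, Θ j then
        (∏ i, gaussSum (Θ i) ψ) * gaussSum (∏ j, Θ j)⁻¹ ψ * (∏ j, Θ j) (-(c : F)) else 0 := by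
  have hq := card_units_ne_zero (F := F)
  apply mul_left_cancel₀ hq
  have h1 : ∀ (z : Fˣ) (y : Fin 4 → Fˣ), ((Fintype.card F : ℂ) - 1) *
      ψ (z * (∑ i, (y i : F) ^ 4 - c * ∏ i, (y i : F))) =
      ∑ φ : MulChar F ℂ, gaussSum φ⁻¹ ψ * φ (-(c : F)) *
        (φ z * ∏ i, (φ (y i) * ψ (z * (y i : F) ^ 4))) := by
    intro z y
    have h := addChar_fourier ψ (-c * z * ∏ i, y i)
    have h2 : ψ (z * (∑ i, (y i : F) ^ 4 - c * ∏ i, (y i : F))) =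
        (∏ i, ψ (z * (y i : F) ^ 4)) * ψ ((-c * z * ∏ i, y i : Fˣ) : F) := by
      rw [← addChar_sum, ← AddChar.map_add_eq_mul, ← Finset.mul_sum]
      congr 1
      push_cast
      ring
    rw [h2, mul_left_comm, h, Finset.mul_sum]
    refine Fintype.sum_equiv (Equiv.inv _) _ _ fun φ => ?_
    simp only [Equiv.inv_apply, inv_inv, Finset.prod_mul_distrib]
    push_cast
    simp only [map_mul, map_prod]
    ring
  simp only [Finset.mul_sum _ _ ((Fintype.card F : ℂ) - 1)]
  simp only [h1]
  rw [Finset.sum_congr rfl fun z _ => Finset.sum_comm, Finset.sum_comm]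
  have h3 : ∀ (φ : MulChar F ℂ) (z : Fˣ),
      ∑ y : Fin 4 → Fˣ, ∏ i, (φ (y i) * ψ (z * (y i : F) ^ 4)) =
      (∑ θ : MulChar F ℂ, (if θ ^ 4 = φ then gaussSum θ ψ else 0) * θ⁻¹ z) ^ 4 := by
    intro φ z
    rw [← sum_mulChar_mul_addChar_pow_four, Fintype.sum_pow]
  simp only [← Finset.mul_sum, h3, sum_units_mul_sum_pow]
  simp only [Finset.mul_sum]
  rw [Finset.sum_comm]
  refine Finset.sum_congr rfl fun Θ _ => ?_
  rw [Finset.sum_eq_single (∏ j, Θ j)]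
  · by_cases h : ∀ i, Θ i ^ 4 = ∏ j, Θ j
    · rw [if_pos rfl, if_pos h]
      simp only [h, if_true]
      ring
    · rw [if_pos rfl, if_neg h]
      obtain ⟨i, hi⟩ := not_forall.1 h
      rw [Finset.prod_eq_zero (mem_univ i) (if_neg hi)]
      ring
  · intro φ _ hφ
    rw [if_neg (Ne.symm hφ)]; ring
  · simp

/-- Including `y = 0` removes the trivial character, as `1 + g(1) = 0`. -/
theorem sum_addChar_pow_four (hψ : ψ ≠ 1) (z : Fˣ) :
    ∑ y : F, ψ (z * y ^ 4) =
      ∑ θ : MulChar F ℂ, (if θ ^ 4 = 1 ∧ θ ≠ 1 then gaussSum θ ψ else 0) * θ⁻¹ z := by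
  have h := sum_mulChar_mul_addChar_pow_four 1 ψ z
  have h0 : ∑ y : F, ψ (z * y ^ 4) = 1 + ∑ y : Fˣ, (1 : MulChar F ℂ) y * ψ (z * y ^ 4) := by
    have := sum_units_eq_sum (f := fun y : F => ψ (z * y ^ 4) - if y = 0 then 1 else 0) (by simp)
    rw [Finset.sum_sub_distrib] at this
    simp at this ⊢
    rw [this]; ring
  rw [h0, h]
  rw [← Finset.add_sum_erase univ _ (mem_univ (1 : MulChar F ℂ)),
    ← Finset.add_sum_erase univ (fun θ => (if θ ^ 4 = 1 ∧ θ ≠ 1 then _ else _) * _)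
      (mem_univ (1 : MulChar F ℂ))]
  simp only [one_pow, if_true, gaussSum_one_char hψ, ne_eq, not_true, and_false, if_false]
  rw [← add_assoc]
  congr 1
  · simp
  · refine Finset.sum_congr rfl fun θ hθ => ?_
    simp [(mem_erase.1 hθ).1]

/-- The contribution of a quadruple of characters `θ_i` with `θ_i⁴ = ∏ θ_j` to `q` times the number
of affine points. The factor `q` occurring when `∏ θ_j = 1` and some `θ_i` is trivial accounts for
the points with a vanishing coordinate. -/
def dworkTerm (ψ : AddChar F ℂ) (c : F) (Θ : Fin 4 → MulChar F ℂ) : ℂ :=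
  (if ∏ j, Θ j = 1 ∧ ∃ i, Θ i = 1 then (Fintype.card F : ℂ) else 1) *
    (∏ i, gaussSum (Θ i) ψ) * gaussSum (∏ j, Θ j)⁻¹ ψ * (∏ j, Θ j) (-c)

/-- On the points with a vanishing coordinate the form is the Fermat quartic, so their sum is the
difference of the Fermat sums over `F⁴` and over `(Fˣ)⁴`. It involves only quadruples with product
`1` and so only changes the weight of those. -/
theorem sum_units_sum_dwork (hψ : ψ ≠ 1) (c : Fˣ) :
    ∑ z : Fˣ, ∑ y : Fin 4 → F, ψ (z * (∑ i, y i ^ 4 - c * ∏ i, y i)) =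
      ∑ Θ : Fin 4 → MulChar F ℂ, if ∀ i, Θ i ^ 4 = ∏ j, Θ j then dworkTerm ψ c Θ else 0 := by
  have hz : ∀ z : Fˣ, ∑ y : Fin 4 → F, ψ (z * (∑ i, y i ^ 4 - c * ∏ i, y i)) =
      ∑ y : Fin 4 → Fˣ, ψ (z * (∑ i, (y i : F) ^ 4 - c * ∏ i, (y i : F))) +
      ((∑ y : F, ψ (z * y ^ 4)) ^ 4 -
        (∑ y : Fˣ, (1 : MulChar F ℂ) y * ψ (z * y ^ 4)) ^ 4) := by
    intro z
    have hi : Function.Injective (fun (y : Fin 4 → Fˣ) i => (y i : F)) :=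
      fun y y' h => funext fun i => Units.ext (congrFun h i)
    have := Fintype.sum_of_injective _ hi
      (fun y => ψ (z * (∑ i, (y i : F) ^ 4 - c * ∏ i, (y i : F))) - ψ (z * ∑ i, (y i : F) ^ 4))
      (fun y : Fin 4 → F => ψ (z * (∑ i, y i ^ 4 - c * ∏ i, y i)) - ψ (z * ∑ i, y i ^ 4))
      (fun y hy => by
        have : ∃ i, y i = 0 := by
          by_contra! h
          exact hy ⟨fun i => Units.mk0 (y i) (h i), rfl⟩
        obtain ⟨i, hi⟩ := this
        simp [Finset.prod_eq_zero (mem_univ i) hi])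
      (fun _ => rfl)
    rw [Finset.sum_sub_distrib, Finset.sum_sub_distrib] at this
    simp only [MulChar.one_apply_coe, one_mul, Fintype.sum_pow, ← addChar_sum]
    simp only [Finset.mul_sum, mul_sub] at this ⊢
    linear_combination -this
  simp only [hz]
  rw [Finset.sum_add_distrib, Finset.sum_sub_distrib, sum_units_tuples_dwork]
  simp only [sum_addChar_pow_four hψ, sum_mulChar_mul_addChar_pow_four]
  have h1 := fun a : MulChar F ℂ → ℂ => sum_units_mul_sum_pow a 1 4
  simp only [MulChar.one_apply_coe, one_mul] at h1
  rw [h1, h1, ← mul_sub, ← Finset.sum_sub_distrib, Finset.mul_sum, ← Finset.sum_add_distrib]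
  refine Finset.sum_congr rfl fun Θ _ => ?_
  by_cases hp : ∏ j, Θ j = 1
  · by_cases h4 : ∀ i, Θ i ^ 4 = 1
    · have hc : (1 : MulChar F ℂ) (-(c : F)) = 1 := by
        rw [← Units.val_neg, MulChar.one_apply_coe]
      by_cases he : ∃ i, Θ i = 1
      · obtain ⟨i, hi⟩ := he
        simp only [dworkTerm, hp, h4, true_and, if_true, implies_true, inv_one,
          gaussSum_one_char hψ, hc, if_pos (⟨i, hi⟩ : ∃ i, Θ i = 1)]
        rw [Finset.prod_eq_zero (f := fun i => if Θ i ≠ 1 then gaussSum (Θ i) ψ else 0)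
          (mem_univ i) (if_neg (not_not.2 hi))]
        ring
      · have he' : ∀ i, Θ i ≠ 1 := not_exists.1 he
        simp [dworkTerm, hp, h4, he', hc]
    · obtain ⟨i, hi⟩ := not_forall.1 h4
      simp only [hp, h4, if_false, if_true]
      rw [Finset.prod_eq_zero (mem_univ i) (if_neg (fun h => hi h.1)),
        Finset.prod_eq_zero (mem_univ i) (if_neg hi)]
      ring
  · simp [hp, dworkTerm]

theorem card_mul_card_affine_dwork (hψ : ψ ≠ 1) (c : Fˣ) :
    (Fintype.card F : ℂ) * #{y : Fin 4 → F | ∑ i, y i ^ 4 - c * ∏ i, y i = 0} =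
      (Fintype.card F : ℂ) ^ 4 +
      ∑ Θ : Fin 4 → MulChar F ℂ, if ∀ i, Θ i ^ 4 = ∏ j, Θ j then dworkTerm ψ c Θ else 0 := by
  rw [← sum_units_sum_dwork hψ, Finset.sum_comm]
  have h : ∀ y : Fin 4 → F, ∑ z : Fˣ, ψ (z * (∑ i, y i ^ 4 - c * ∏ i, y i)) =
      (if ∑ i, y i ^ 4 - c * ∏ i, y i = 0 then (Fintype.card F : ℂ) else 0) - 1 := by
    intro y
    have h := AddChar.sum_mulShift (∑ i, y i ^ 4 - c * ∏ i, y i)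
      (AddChar.IsPrimitive.of_ne_one hψ)
    have h0 := sum_units_eq_sum (F := F)
      (f := fun x => ψ (x * (∑ i, y i ^ 4 - c * ∏ i, y i)) - if x = 0 then 1 else 0) (by simp)
    rw [Finset.sum_sub_distrib, Finset.sum_sub_distrib, h] at h0
    simpa using h0
  simp only [h]
  rw [Finset.sum_sub_distrib, ← Finset.sum_filter, Finset.sum_const]
  simp
  ring

/-- A nonzero zero of the quartic is a unit multiple of the chosen representative of exactly one
point of the surface. -/
theorem ncard_dworkPoints (u : F) :
    (Fintype.card F - 1) * (dworkPoints u).ncard + 1 =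
      #{y : Fin 4 → F | ∑ i, y i ^ 4 - 4 * u⁻¹ * ∏ i, y i = 0} := by
  set Q : (Fin 4 → F) → F := fun y => ∑ i, y i ^ 4 - 4 * u⁻¹ * ∏ i, y i with hQ
  have hev : ∀ y, MvPolynomial.eval y (dworkQuartic u) = Q y := by
    intro y; simp [dworkQuartic, hQ]
  have hsm : ∀ (a : F) y, Q (a • y) = a ^ 4 * Q y := by
    intro a y
    simp only [hQ, Pi.smul_apply, smul_eq_mul, mul_pow, Finset.prod_mul_distrib,
      ← Finset.mul_sum, Finset.prod_const, Finset.card_univ, Fintype.card_fin]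
    ring
  have h0 : (0 : Fin 4 → F) ∈ (univ.filter fun y => Q y = 0) := by simp [hQ]
  change _ = #(univ.filter fun y => Q y = 0)
  rw [← Finset.card_erase_add_one h0, add_left_inj]
  have : (Fintype.card F - 1) = Fintype.card Fˣ := by
    rw [Fintype.card_eq_card_units_add_one (α := F)]; rfl
  rw [this, ← Nat.card_coe_set_eq, ← Nat.card_eq_fintype_card, ← Nat.card_prod,
    ← Fintype.card_coe, ← Nat.card_eq_fintype_card]
  refine Nat.card_congr (Equiv.ofBijective (fun p => ⟨(p.1 : F) • p.2.1.rep, ?_⟩) ⟨?_, ?_⟩)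
  · have := p.2.2
    simp only [dworkPoints, Set.mem_ofPred_eq, hev] at this
    rw [mem_erase, mem_filter, hsm, this, mul_zero]
    exact ⟨smul_ne_zero p.1.ne_zero p.2.1.rep_nonzero, mem_univ _, rfl⟩
  · rintro ⟨a, P, hP⟩ ⟨b, P', hP'⟩ h
    have h : (a : F) • P.rep = (b : F) • P'.rep := congrArg Subtype.val h
    have hPP : P = P' := by
      rw [← P.mk_rep, ← P'.mk_rep, Projectivization.mk_eq_mk_iff]
      refine ⟨a⁻¹ * b, ?_⟩
      rw [mul_smul, Units.smul_def b, ← h, ← Units.smul_def, inv_smul_smul]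
    subst hPP
    have hab : a = b := Units.ext (smul_left_injective F P.rep_nonzero h)
    rw [hab]
  · rintro ⟨y, hy⟩
    rw [mem_erase, mem_filter] at hy
    obtain ⟨a, ha⟩ := Projectivization.exists_smul_eq_mk_rep F y hy.1
    refine ⟨(a⁻¹, ⟨Projectivization.mk F y hy.1, ?_⟩), Subtype.ext ?_⟩
    · simp only [dworkPoints, Set.mem_ofPred_eq, hev]
      rw [← ha, Units.smul_def, hsm, hy.2.2, mul_zero]
    · change ((a⁻¹ : Fˣ) : F) • (Projectivization.mk F y hy.1).rep = y
      rw [← ha, ← Units.smul_def, inv_smul_smul]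

end PointCount

/-! ### Classes of quadruples -/

section Classes

variable {F : Type*} [Field F] [Fintype F] {ψ : AddChar F ℂ}

theorem image_pow_eq_univ {χ : MulChar F ℂ} (hχ : orderOf χ = Fintype.card F - 1) :
    (range (Fintype.card F - 1)).image (fun m => χ ^ m) = univ ∧
    Set.InjOn (fun m => χ ^ m) (range (Fintype.card F - 1) : Set ℕ) := by
  have hinj : Set.InjOn (fun m => χ ^ m) (range (Fintype.card F - 1) : Set ℕ) := by
    intro a ha b hb h
    rw [coe_range, ← hχ] at ha hb
    exact pow_injOn_Iio_orderOf ha hb h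
  refine ⟨Finset.eq_univ_of_card _ ?_, hinj⟩
  rw [Finset.card_image_of_injOn hinj, card_range, card_mulChar,
    Fintype.card_eq_card_units_add_one (α := F)]
  rfl

theorem sum_range_mulChar_pow {χ : MulChar F ℂ} (hχ : orderOf χ = Fintype.card F - 1)
    (f : MulChar F ℂ → ℂ) :
    ∑ m ∈ range (Fintype.card F - 1), f (χ ^ m) = ∑ φ : MulChar F ℂ, f φ := by
  rw [← (image_pow_eq_univ hχ).1, Finset.sum_image (image_pow_eq_univ hχ).2]

theorem exists_pow_eq {χ : MulChar F ℂ} (hχ : orderOf χ = Fintype.card F - 1)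
    (φ : MulChar F ℂ) : ∃ m : ℕ, χ ^ m = φ := by
  have := mem_univ φ
  rw [← (image_pow_eq_univ hχ).1, mem_image] at this
  obtain ⟨m, _, h⟩ := this
  exact ⟨m, h⟩

/-- The quadruples of characters `θ_i` with `θ_i⁴ = ∏ θ_j` for all `i` are the
`(θ, θ ε₁, θ ε₂, θ (ε₁ ε₂)⁻¹)` with `ε₁⁴ = ε₂⁴ = 1`. -/
theorem sum_quadruples (f : (Fin 4 → MulChar F ℂ) → ℂ) :
    (∑ Θ : Fin 4 → MulChar F ℂ, if ∀ i, Θ i ^ 4 = ∏ j, Θ j then f Θ else 0) =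
      ∑ ε₁ : MulChar F ℂ with ε₁ ^ 4 = 1, ∑ ε₂ : MulChar F ℂ with ε₂ ^ 4 = 1,
        ∑ θ : MulChar F ℂ, f ![θ, θ * ε₁, θ * ε₂, θ * (ε₁ * ε₂)⁻¹] := by
  rw [← Finset.sum_filter, ← Finset.sum_product', ← Finset.sum_product']
  symm
  refine Finset.sum_bij'
    (i := fun p _ => ![p.2, p.2 * p.1.1, p.2 * p.1.2, p.2 * (p.1.1 * p.1.2)⁻¹])
    (j := fun Θ _ => (((Θ 0)⁻¹ * Θ 1, (Θ 0)⁻¹ * Θ 2), Θ 0)) ?_ ?_ ?_ ?_ (fun _ _ => rfl)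
  · rintro ⟨⟨a, b⟩, t⟩ h
    simp only [mem_product, mem_filter, mem_univ, true_and, and_true] at h ⊢
    have hprod : t * (t * a) * (t * b) * (t * (a * b)⁻¹) = t ^ 4 := by
      calc _ = t * t * t * t * ((a * b) * (a * b)⁻¹) := by ac_rfl
        _ = t ^ 4 := by rw [mul_inv_cancel, mul_one]; simp only [pow_succ, pow_zero, one_mul]
    simp only [Fin.prod_univ_four, Matrix.cons_val, hprod]
    intro i
    fin_cases i <;> simp [mul_pow, h.1, h.2]
  · intro Θ h
    simp only [mem_product, mem_filter, mem_univ, true_and, and_true] at h ⊢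
    constructor <;> simp [mul_pow, h]
  · rintro ⟨⟨a, b⟩, t⟩ h
    simp
  · intro Θ h
    simp only [mem_filter, mem_univ, true_and] at h
    have h0 := h 0
    rw [Fin.prod_univ_four] at h0
    have h3 : Θ 1 * Θ 2 * Θ 3 = Θ 0 * Θ 0 * Θ 0 := mul_left_cancel (a := Θ 0) (by
      rw [← mul_assoc, ← mul_assoc, ← h0]
      simp only [pow_succ, pow_zero, one_mul]
      ac_rfl)
    funext i
    fin_cases i
    · rfl
    · simp
    · simp
    · simp only [Fin.reduceFinMk, Matrix.cons_val]
      rw [mul_inv_eq_iff_eq_mul]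
      symm
      calc _ = (Θ 0)⁻¹ * (Θ 0)⁻¹ * (Θ 1 * Θ 2 * Θ 3) := by ac_rfl
        _ = ((Θ 0)⁻¹ * Θ 0) * ((Θ 0)⁻¹ * Θ 0) * Θ 0 := by rw [h3]; ac_rfl
        _ = Θ 0 := by simp

theorem dworkTerm_comp_perm (c : F) (Θ : Fin 4 → MulChar F ℂ) (σ : Equiv.Perm (Fin 4)) :
    dworkTerm ψ c (Θ ∘ σ) = dworkTerm ψ c Θ := by
  have h1 : ∏ j, (Θ ∘ σ) j = ∏ j, Θ j := Equiv.prod_comp σ Θ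
  have h2 : ∏ j, gaussSum ((Θ ∘ σ) j) ψ = ∏ j, gaussSum (Θ j) ψ :=
    Equiv.prod_comp σ fun j => gaussSum (Θ j) ψ
  have h3 : (∃ i, (Θ ∘ σ) i = 1) ↔ ∃ i, Θ i = 1 :=
    ⟨fun ⟨i, h⟩ => ⟨σ i, h⟩, fun ⟨i, h⟩ => ⟨σ.symm i, by simpa using h⟩⟩
  simp only [dworkTerm, h1, h2, h3]

/-- The total contribution of the quadruples `(θ, θ a, θ b, θ d)`, where `θ` runs through all
characters. -/
def dworkClassSum (ψ : AddChar F ℂ) (c : F) (a b d : MulChar F ℂ) : ℂ :=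
  ∑ θ : MulChar F ℂ, dworkTerm ψ c ![θ, θ * a, θ * b, θ * d]

theorem dworkClassSum_swap_left (c : F) (a b d : MulChar F ℂ) :
    dworkClassSum ψ c a b d = dworkClassSum ψ c b a d := by
  refine Finset.sum_congr rfl fun θ _ => ?_
  rw [← dworkTerm_comp_perm c _ (Equiv.swap 1 2)]
  congr 1
  funext i
  fin_cases i <;> rfl

theorem dworkClassSum_swap_right (c : F) (a b d : MulChar F ℂ) :
    dworkClassSum ψ c a b d = dworkClassSum ψ c a d b := by
  refine Finset.sum_congr rfl fun θ _ => ?_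
  rw [← dworkTerm_comp_perm c _ (Equiv.swap 2 3)]
  congr 1
  funext i
  fin_cases i <;> rfl

/-- Replacing `θ` by `θ a⁻¹` and exchanging the first two entries. -/
theorem dworkClassSum_shift (c : F) (a b d : MulChar F ℂ) :
    dworkClassSum ψ c a b d = dworkClassSum ψ c a⁻¹ (a⁻¹ * b) (a⁻¹ * d) := by
  refine Fintype.sum_equiv (Equiv.mulRight a) _ _ fun θ => ?_
  rw [← dworkTerm_comp_perm c _ (Equiv.swap 0 1)]
  congr 1
  funext i
  fin_cases i <;> simp [Equiv.swap_apply_def]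

theorem filter_pow_four_of_mod_three (hq : Fintype.card F % 4 = 3) {χ : MulChar F ℂ}
    (hχ : orderOf χ = Fintype.card F - 1) :
    (univ.filter fun ε : MulChar F ℂ => ε ^ 4 = 1) = {1, χ ^ ((Fintype.card F - 1) / 2)} := by
  obtain ⟨h, hh⟩ : ∃ h, Fintype.card F - 1 = 2 * h := ⟨(Fintype.card F - 1) / 2, by omega⟩
  have hh2 : (Fintype.card F - 1) / 2 = h := by omega
  have hodd : h % 2 = 1 := by omega
  rw [hh2]
  rw [hh] at hχ
  have hη : (χ ^ h) ^ 2 = 1 := by rw [← pow_mul, mul_comm, ← hχ, pow_orderOf_eq_one]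
  ext ε
  simp only [mem_filter, mem_univ, true_and, mem_insert, mem_singleton]
  constructor
  · intro h4
    obtain ⟨m, rfl⟩ := exists_pow_eq (hh ▸ hχ) ε
    rw [← pow_mul, ← orderOf_dvd_iff_pow_eq_one, hχ] at h4
    have hc : Nat.Coprime h 2 := by
      rw [Nat.coprime_comm, Nat.coprime_two_left]
      exact Nat.odd_iff.2 hodd
    have h5 : h ∣ m * 2 := by
      obtain ⟨k, hk⟩ := h4
      exact ⟨k, by linarith⟩
    obtain ⟨k, rfl⟩ := hc.dvd_of_dvd_mul_right h5
    rw [pow_mul]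
    rcases Nat.even_or_odd' k with ⟨j, rfl | rfl⟩
    · left; rw [pow_mul, hη, one_pow]
    · right; rw [pow_add, pow_mul, hη, one_pow, one_mul, pow_one]
  · rintro (rfl | rfl)
    · simp
    · rw [show 4 = 2 * 2 by rfl, pow_mul, hη, one_pow]

theorem filter_pow_four_of_mod_one (hq : Fintype.card F % 4 = 1) {χ : MulChar F ℂ}
    (hχ : orderOf χ = Fintype.card F - 1) :
    (univ.filter fun ε : MulChar F ℂ => ε ^ 4 = 1) =
      (range 4).image fun j => (χ ^ ((Fintype.card F - 1) / 4)) ^ j := by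
  obtain ⟨h, hh⟩ : ∃ h, Fintype.card F - 1 = 4 * h := ⟨(Fintype.card F - 1) / 4, by omega⟩
  have hh2 : (Fintype.card F - 1) / 4 = h := by omega
  rw [hh2]
  rw [hh] at hχ
  have hη : (χ ^ h) ^ 4 = 1 := by rw [← pow_mul, mul_comm, ← hχ, pow_orderOf_eq_one]
  ext ε
  simp only [mem_filter, mem_univ, true_and, mem_image, mem_range]
  constructor
  · intro h4
    obtain ⟨m, rfl⟩ := exists_pow_eq (hh ▸ hχ) ε
    rw [← pow_mul, ← orderOf_dvd_iff_pow_eq_one, hχ] at h4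
    have h5 : h ∣ m := by
      obtain ⟨k, hk⟩ := h4
      exact ⟨k, by linarith⟩
    obtain ⟨k, rfl⟩ := h5
    refine ⟨k % 4, Nat.mod_lt _ (by norm_num), ?_⟩
    rw [pow_mul, ← pow_mod_orderOf (χ ^ h) k, ← pow_mod_orderOf (χ ^ h) (k % 4),
      Nat.mod_mod_of_dvd _ (orderOf_dvd_of_pow_eq_one hη)]
  · rintro ⟨j, -, rfl⟩
    rw [pow_right_comm, hη, one_pow]

theorem pow_injOn_range_four (hq : Fintype.card F % 4 = 1) {χ : MulChar F ℂ}
    (hχ : orderOf χ = Fintype.card F - 1) :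
    Set.InjOn (fun j => (χ ^ ((Fintype.card F - 1) / 4)) ^ j) (range 4 : Set ℕ) := by
  have hc : 1 < Fintype.card F := Fintype.one_lt_card
  have : orderOf (χ ^ ((Fintype.card F - 1) / 4)) = 4 := by
    rw [orderOf_pow_of_dvd (by omega) (hχ ▸ Nat.div_dvd_of_dvd (by omega)), hχ]
    obtain ⟨h, hh⟩ : ∃ h, Fintype.card F - 1 = 4 * h := ⟨(Fintype.card F - 1) / 4, by omega⟩
    rw [hh]
    have : 0 < h := by omega
    rw [Nat.mul_div_cancel_left h (by norm_num), Nat.mul_div_cancel _ this]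
  intro a ha b hb h
  rw [coe_range, ← this] at ha hb
  exact pow_injOn_Iio_orderOf ha hb h

theorem sum_dworkTerm_of_mod_three (hq : Fintype.card F % 4 = 3) {χ : MulChar F ℂ}
    (hχ : orderOf χ = Fintype.card F - 1) (c : F) {η : MulChar F ℂ}
    (hη : η = χ ^ ((Fintype.card F - 1) / 2)) (hη1 : η ≠ 1) (hη2 : η * η = 1) :
    (∑ Θ : Fin 4 → MulChar F ℂ, if ∀ i, Θ i ^ 4 = ∏ j, Θ j then dworkTerm ψ c Θ else 0) =
      dworkClassSum ψ c 1 1 1 + 3 * dworkClassSum ψ c 1 η η := by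
  have hηi : η⁻¹ = η := inv_eq_of_mul_eq_one_left hη2
  rw [sum_quadruples]
  simp only [filter_pow_four_of_mod_three hq hχ, ← hη, Finset.sum_pair hη1.symm]
  change dworkClassSum ψ c _ _ _ + dworkClassSum ψ c _ _ _ +
    (dworkClassSum ψ c _ _ _ + dworkClassSum ψ c _ _ _) = _
  simp only [one_mul, mul_one, inv_one, hηi, hη2]
  rw [dworkClassSum_swap_right c η η 1, dworkClassSum_swap_left c η 1 η]
  ring

/-- The sixteen pairs `(ε₁, ε₂)` fall into three classes under permutations and shifts: the trivial
one, three of type `(1, ι², ι²)` and twelve of type `(1, ι, ι³)`. -/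
theorem sum_dworkTerm_of_mod_one (hq : Fintype.card F % 4 = 1) {χ : MulChar F ℂ}
    (hχ : orderOf χ = Fintype.card F - 1) (c : F) {ι : MulChar F ℂ}
    (hι : ι = χ ^ ((Fintype.card F - 1) / 4)) (h4 : ι ^ 4 = 1) :
    (∑ Θ : Fin 4 → MulChar F ℂ, if ∀ i, Θ i ^ 4 = ∏ j, Θ j then dworkTerm ψ c Θ else 0) =
      dworkClassSum ψ c 1 1 1 + 3 * dworkClassSum ψ c 1 (ι ^ 2) (ι ^ 2) +
        12 * dworkClassSum ψ c 1 ι (ι ^ 3) := by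
  have hinj := pow_injOn_range_four hq hχ
  rw [sum_quadruples, filter_pow_four_of_mod_one hq hχ]
  rw [← hι] at hinj ⊢
  simp only [Finset.sum_image hinj]
  change ∑ a ∈ range 4, ∑ b ∈ range 4,
    dworkClassSum ψ c (ι ^ a) (ι ^ b) (ι ^ a * ι ^ b)⁻¹ = _
  have hinv : ∀ a b d : ℕ, a + b + d = 0 ∨ a + b + d = 4 ∨ a + b + d = 8 →
      (ι ^ a * ι ^ b)⁻¹ = ι ^ d := by
    intro a b d h
    rw [inv_eq_iff_mul_eq_one, ← pow_add, ← pow_add]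
    rcases h with h | h | h <;> rw [h]
    · simp
    · exact h4
    · rw [show 8 = 4 * 2 by rfl, pow_mul, h4, one_pow]
  simp only [Finset.sum_range_succ, Finset.sum_range_zero, zero_add]
  rw [hinv 0 0 0 (by simp), hinv 0 1 3 (by simp), hinv 0 2 2 (by simp), hinv 0 3 1 (by simp),
    hinv 1 0 3 (by simp), hinv 1 1 2 (by simp), hinv 1 2 1 (by simp), hinv 1 3 0 (by simp),
    hinv 2 0 2 (by simp), hinv 2 1 1 (by simp), hinv 2 2 0 (by simp), hinv 2 3 3 (by simp),
    hinv 3 0 1 (by simp), hinv 3 1 0 (by simp), hinv 3 2 3 (by simp), hinv 3 3 2 (by simp)]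
  have hi1 : (ι ^ 1)⁻¹ = ι ^ 3 := by simpa using hinv 1 0 3 (by simp)
  have hi3 : (ι ^ 3)⁻¹ = ι ^ 1 := by simpa using hinv 3 0 1 (by simp)
  -- The types `(ι, ι, ι²)` and `(ι³, ι³, ι²)` are shifts of `(1, ι, ι³)`.
  have e1 : dworkClassSum ψ c (ι ^ 1) (ι ^ 1) (ι ^ 2) =
      dworkClassSum ψ c (ι ^ 0) (ι ^ 1) (ι ^ 3) := by
    rw [dworkClassSum_shift, inv_mul_cancel, hi1, ← pow_add, dworkClassSum_swap_left,
      dworkClassSum_swap_right, pow_zero]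
    congr 1
    rw [show 3 + 2 = 4 + 1 by rfl, pow_add, h4, one_mul]
  have e2 : dworkClassSum ψ c (ι ^ 3) (ι ^ 3) (ι ^ 2) =
      dworkClassSum ψ c (ι ^ 0) (ι ^ 1) (ι ^ 3) := by
    rw [dworkClassSum_shift, inv_mul_cancel, hi3, ← pow_add, dworkClassSum_swap_left, pow_zero]
  rw [dworkClassSum_swap_right c (ι ^ 0) (ι ^ 3), dworkClassSum_swap_left c (ι ^ 1) (ι ^ 0),
    dworkClassSum_swap_right c (ι ^ 1) (ι ^ 2), e1,
    dworkClassSum_swap_right c (ι ^ 1) (ι ^ 3), dworkClassSum_swap_left c (ι ^ 1) (ι ^ 0),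
    dworkClassSum_swap_left c (ι ^ 2) (ι ^ 0), dworkClassSum_swap_left c (ι ^ 2) (ι ^ 1),
    dworkClassSum_swap_right c (ι ^ 1) (ι ^ 2), e1,
    dworkClassSum_swap_right c (ι ^ 2) (ι ^ 2), dworkClassSum_swap_left c (ι ^ 2) (ι ^ 0),
    dworkClassSum_swap_left c (ι ^ 2) (ι ^ 3), dworkClassSum_swap_right c (ι ^ 3) (ι ^ 2), e2,
    dworkClassSum_swap_left c (ι ^ 3) (ι ^ 0), dworkClassSum_swap_right c (ι ^ 0) (ι ^ 3),
    dworkClassSum_swap_right c (ι ^ 3) (ι ^ 1), dworkClassSum_swap_left c (ι ^ 3) (ι ^ 0),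
    dworkClassSum_swap_right c (ι ^ 0) (ι ^ 3)]
  simp only [pow_zero, pow_one]
  ring

end Classes

/-! ### The contributions of the three classes -/

section Contributions

variable {F : Type*} [Field F]

theorem inv_pow_four_apply (φ : MulChar F ℂ) (u : F) (h4 : (4 : F) ≠ 0) (hu : u ≠ 0) :
    (φ⁻¹ ^ 4) (-(4 * u⁻¹)) = φ (u ^ 4 / 4 ^ 4) := by
  rw [MulChar.pow_apply' _ (by norm_num), MulChar.inv_apply', ← map_pow]
  congr 1
  field_simp

variable [Fintype F] {ψ : AddChar F ℂ}

/-- `∑_φ w(φ) g(φ⁻¹)⁴ g(φ⁴) φ(t / 4⁴)` with `w(1) = q` and `w(φ) = 1` otherwise: the contribution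
of the quadruples `(θ, θ, θ, θ)` at `t = u⁴`, and `q (q - 1)` times the hypergeometric sum with
parameters `(1/4, 1/2, 3/4; 1, 1, 1)`. -/
def quarticCharSum (ψ : AddChar F ℂ) (t : F) : ℂ :=
  ∑ φ : MulChar F ℂ, (if φ = 1 then (Fintype.card F : ℂ) else 1) *
    (gaussSum φ⁻¹ ψ ^ 4 * gaussSum (φ ^ 4) ψ) * φ (t / 4 ^ 4)

/-- `∑_φ w(φ) g(φ⁻²)² g(φ⁴) φ(t / 4²)` with `w(φ) = q` if `φ² = 1` and `w(φ) = 1` otherwise: up to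
the factor `η(-1) q` the contribution of the quadruples `(θ, θ, θ η, θ η)` at `t = u⁴`, and
`q (q - 1)` times the hypergeometric sum with parameters `(1/4, 3/4; 1/2, 1)`. -/
def quadraticCharSum (ψ : AddChar F ℂ) (t : F) : ℂ :=
  ∑ φ : MulChar F ℂ, (if φ ^ 2 = 1 then (Fintype.card F : ℂ) else 1) *
    (gaussSum (φ⁻¹ ^ 2) ψ ^ 2 * gaussSum (φ ^ 4) ψ) * φ (t / 4 ^ 2)

/-- The reflection formula, uniformly in `φ`: the factor `q` at `φ = 1` is the source of the weights
in `quarticCharSum` and `quadraticCharSum`. -/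
theorem card_div_gaussSum (hψ : ψ ≠ 1) (φ : MulChar F ℂ) :
    (Fintype.card F : ℂ) / gaussSum φ ψ =
      (if φ = 1 then (Fintype.card F : ℂ) else 1) * φ (-1) * gaussSum φ⁻¹ ψ := by
  rw [div_eq_iff (gaussSum_ne_zero hψ φ)]
  split_ifs with h
  · subst h
    rw [inv_one, gaussSum_one_char hψ, MulChar.one_apply (by simp)]
    ring
  · have := gaussSum_mul_gaussSum_inv hψ h
    linear_combination -φ (-1) * this - Fintype.card F * φ.apply_neg_one_sq

theorem gaussSum_sq_of_quadratic (hψ : ψ ≠ 1) {η : MulChar F ℂ} (hη : η ≠ 1)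
    (hη2 : η * η = 1) : gaussSum η ψ ^ 2 = η (-1) * Fintype.card F := by
  rw [← gaussSum_mul_gaussSum_inv hψ hη, inv_eq_of_mul_eq_one_left hη2, sq]

theorem dworkClassSum_one_one_one (u : F) (h4 : (4 : F) ≠ 0) (hu : u ≠ 0) :
    dworkClassSum ψ (4 * u⁻¹) 1 1 1 = quarticCharSum ψ (u ^ 4) := by
  rw [dworkClassSum, ← Equiv.sum_comp (Equiv.inv (MulChar F ℂ))]
  refine Finset.sum_congr rfl fun φ _ => ?_
  have hp : ∏ j, (![φ⁻¹, φ⁻¹ * 1, φ⁻¹ * 1, φ⁻¹ * 1] : Fin 4 → MulChar F ℂ) j = φ⁻¹ ^ 4 := by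
    simp [Fin.prod_univ_four, pow_succ]
  have hG : ∏ j, gaussSum ((![φ⁻¹, φ⁻¹ * 1, φ⁻¹ * 1, φ⁻¹ * 1] : Fin 4 → MulChar F ℂ) j) ψ =
      gaussSum φ⁻¹ ψ ^ 4 := by
    simp [Fin.prod_univ_four, pow_succ]
  have hw : (φ⁻¹ ^ 4 = 1 ∧ ∃ i, (![φ⁻¹, φ⁻¹ * 1, φ⁻¹ * 1, φ⁻¹ * 1] : Fin 4 → MulChar F ℂ) i = 1) ↔
      φ = 1 := by
    simp only [Fin.exists_fin_succ]
    simp +contextual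
  simp only [Equiv.inv_apply, dworkTerm, hp, hG, hw, inv_pow_four_apply φ u h4 hu]
  simp only [inv_pow, inv_inv]
  ring

theorem dworkClassSum_one_quadratic (hψ : ψ ≠ 1) (hF : ringChar F ≠ 2) (u : F) (hu : u ≠ 0)
    {η : MulChar F ℂ} (hη : η ≠ 1) (hη2 : η * η = 1) :
    dworkClassSum ψ (4 * u⁻¹) 1 η η =
      η (-1) * Fintype.card F * quadraticCharSum ψ (u ^ 4) := by
  have h4 : (4 : F) ≠ 0 := four_cast_ne_zero hF
  rw [dworkClassSum, ← Equiv.sum_comp (Equiv.inv (MulChar F ℂ)), quadraticCharSum, Finset.mul_sum]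
  refine Finset.sum_congr rfl fun φ _ => ?_
  have hp : ∏ j, (![φ⁻¹, φ⁻¹ * 1, φ⁻¹ * η, φ⁻¹ * η] : Fin 4 → MulChar F ℂ) j = φ⁻¹ ^ 4 := by
    simp only [Fin.prod_univ_four, Matrix.cons_val]
    calc _ = φ⁻¹ * φ⁻¹ * φ⁻¹ * φ⁻¹ * (η * η) := by rw [mul_one]; ac_rfl
      _ = φ⁻¹ ^ 4 := by rw [hη2]; simp [pow_succ]
  have hd := gaussSum_duplication hψ hF hη (by rwa [sq]) φ⁻¹
  rw [inv_inv] at hd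
  have hG : ∏ j, gaussSum ((![φ⁻¹, φ⁻¹ * 1, φ⁻¹ * η, φ⁻¹ * η] : Fin 4 → MulChar F ℂ) j) ψ =
      (φ 4 * gaussSum (φ⁻¹ ^ 2) ψ * gaussSum η ψ) ^ 2 := by
    rw [← hd]
    simp only [Fin.prod_univ_four, Matrix.cons_val, mul_one]
    ring
  have hw : (φ⁻¹ ^ 4 = 1 ∧ ∃ i, (![φ⁻¹, φ⁻¹ * 1, φ⁻¹ * η, φ⁻¹ * η] : Fin 4 → MulChar F ℂ) i = 1) ↔
      φ ^ 2 = 1 := by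
    simp only [Fin.exists_fin_succ]
    constructor
    · rintro ⟨-, h⟩
      have : φ = 1 ∨ φ = η := by
        simpa [inv_mul_eq_one] using h
      rcases this with rfl | rfl
      · simp
      · rw [sq, hη2]
    · intro h
      refine ⟨by rw [inv_pow, show 4 = 2 * 2 by rfl, pow_mul, h]; simp, ?_⟩
      by_cases h1 : φ = 1
      · simp [h1]
      · have := eq_of_sq_eq_one h1 h hη (by rwa [sq])
        simp [this]
  have h16 : φ 4 ^ 2 * φ (u ^ 4 / 4 ^ 4) = φ (u ^ 4 / 4 ^ 2) := by
    rw [← map_pow, ← map_mul]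
    congr 1
    field_simp
  simp only [Equiv.inv_apply, dworkTerm, hp, hG, hw, inv_pow_four_apply φ u h4 hu]
  rw [← h16, mul_pow, mul_pow, gaussSum_sq_of_quadratic hψ hη hη2]
  simp only [inv_pow, inv_inv]
  ring

/-- Duplication applied to `φ ι`, for `ι` of order four. The constant is `ι⁻¹(4) = ι(-1)`, which the
case `φ = 1` of the formula itself provides, since `g(ι) g(ι³) = ι(-1) q` and `g(ι²)² = q`. -/
theorem gaussSum_quadruplication (hψ : ψ ≠ 1) (hF : ringChar F ≠ 2) {ι : MulChar F ℂ}
    (h2 : ι ^ 2 ≠ 1) (h4 : ι ^ 4 = 1) :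
    ∀ φ : MulChar F ℂ, gaussSum (φ * ι) ψ * gaussSum (φ * ι ^ 3) ψ =
      φ⁻¹ 4 * ι (-1) * gaussSum (φ ^ 2 * ι ^ 2) ψ * gaussSum (ι ^ 2) ψ := by
  have hη2 : (ι ^ 2) ^ 2 = 1 := by rw [← pow_mul, h4]
  have hι : ι ≠ 1 := fun h => h2 (by rw [h, one_pow])
  have h3 : ι⁻¹ = ι ^ 3 := inv_eq_of_mul_eq_one_right (by rw [← pow_succ', h4])
  have hd : ∀ φ : MulChar F ℂ, gaussSum (φ * ι) ψ * gaussSum (φ * ι ^ 3) ψ =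
      φ⁻¹ 4 * ι⁻¹ 4 * gaussSum (φ ^ 2 * ι ^ 2) ψ * gaussSum (ι ^ 2) ψ := by
    intro φ
    have := gaussSum_duplication hψ hF h2 hη2 (φ * ι)
    rw [mul_assoc, ← pow_succ', mul_pow, mul_inv, MulChar.mul_apply] at this
    exact this
  have hc : ι⁻¹ 4 = ι (-1) := by
    have h := hd 1
    have h1 := gaussSum_mul_gaussSum_inv hψ hι
    have hs := gaussSum_sq_of_quadratic hψ h2 (by rw [← sq, hη2])
    have hm : (ι ^ 2) (-1) = 1 := by
      rw [MulChar.pow_apply' _ two_ne_zero, sq, ι.apply_neg_one_sq]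
    have h14 : (1 : MulChar F ℂ) 4 = 1 := MulChar.one_apply 
      (isUnit_iff_ne_zero.2 (four_cast_ne_zero hF))
    rw [hm, one_mul] at hs
    rw [one_mul, one_mul, ← h3, h1, inv_one, h14, one_pow, one_mul, one_mul, mul_assoc, ← sq,
      hs] at h
    exact (mul_right_cancel₀ card_field_ne_zero h).symm
  simpa only [hc] using hd

/-- The quadruples `(θ, θ, θ ι, θ ι³)`. The multiplication formula for `4` replaces three of the
Gauss sums by `g(θ⁴) / g(θ ι²)`, and `g(θ⁴)` cancels against `g(θ⁻⁴)`, so that a sum with parameters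
`(1/2; 1)` remains. -/
theorem dworkClassSum_one_quartic (hψ : ψ ≠ 1) (hF : ringChar F ≠ 2) (u : F) (hu : u ≠ 0)
    {ι : MulChar F ℂ} (h2 : ι ^ 2 ≠ 1) (h4 : ι ^ 4 = 1) :
    dworkClassSum ψ (4 * u⁻¹) 1 ι (ι ^ 3) = ι (-1) * (Fintype.card F : ℂ) ^ 2 *
      ∑ φ : MulChar F ℂ, gaussSum (φ * ι ^ 2) ψ * gaussSum φ⁻¹ ψ / gaussSum (ι ^ 2) ψ *
        φ (-(u ^ 4)) := by
  have hq := card_field_ne_zero (F := F)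
  have h40 : (4 : F) ≠ 0 := four_cast_ne_zero hF
  have hη2 : (ι ^ 2) ^ 2 = 1 := by rw [← pow_mul, h4]
  have hηi : (ι ^ 2)⁻¹ = ι ^ 2 := inv_eq_of_mul_eq_one_left (by rw [← sq, hη2])
  have hηm : (ι ^ 2) (-1) = 1 := by
    rw [MulChar.pow_apply' _ two_ne_zero, sq, ι.apply_neg_one_sq]
  rw [dworkClassSum, ← Equiv.sum_comp (Equiv.inv (MulChar F ℂ)), Finset.mul_sum]
  refine Finset.sum_congr rfl fun φ _ => ?_
  have hp : ∏ j, (![φ⁻¹, φ⁻¹ * 1, φ⁻¹ * ι, φ⁻¹ * ι ^ 3] : Fin 4 → MulChar F ℂ) j = φ⁻¹ ^ 4 := by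
    simp only [Fin.prod_univ_four, Matrix.cons_val]
    calc _ = φ⁻¹ * φ⁻¹ * φ⁻¹ * φ⁻¹ * (ι * ι ^ 3) := by rw [mul_one]; ac_rfl
      _ = φ⁻¹ ^ 4 := by rw [← pow_succ', h4]; simp [pow_succ]
  have hs := gaussSum_sq_of_quadratic hψ h2 (by rw [← sq, hη2])
  rw [hηm, one_mul] at hs
  have hE := gaussSum_ne_zero hψ (ι ^ 2)
  have hdne := gaussSum_ne_zero hψ (φ⁻¹ * ι ^ 2)
  have hd1 := gaussSum_duplication hψ hF h2 hη2 φ⁻¹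
  have hd2 := gaussSum_quadruplication hψ hF h2 h4 φ⁻¹
  have hd3 := gaussSum_duplication hψ hF h2 hη2 (φ⁻¹ ^ 2)
  rw [← pow_mul] at hd3
  have hinv2 : (φ⁻¹ ^ 2)⁻¹ = φ ^ 2 := by simp
  rw [hinv2, MulChar.pow_apply' _ two_ne_zero] at hd3
  rw [inv_inv] at hd1 hd2
  have hG : ∏ j, gaussSum ((![φ⁻¹, φ⁻¹ * 1, φ⁻¹ * ι, φ⁻¹ * ι ^ 3] : Fin 4 → MulChar F ℂ) j) ψ =
      gaussSum φ⁻¹ ψ * (φ 4 ^ 4 * ι (-1) * gaussSum (φ⁻¹ ^ 4) ψ * Fintype.card F *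
        gaussSum (ι ^ 2) ψ / gaussSum (φ⁻¹ * ι ^ 2) ψ) := by
    simp only [Fin.prod_univ_four, Matrix.cons_val, mul_one]
    rw [mul_assoc (gaussSum φ⁻¹ ψ * _), hd2]
    field_simp
    rw [← hs]
    linear_combination (gaussSum φ⁻¹ ψ * φ 4 * ι (-1) * gaussSum (φ⁻¹ ^ 2 * ι ^ 2) ψ) * hd1 +
      (gaussSum φ⁻¹ ψ * φ 4 ^ 2 * ι (-1) * gaussSum (ι ^ 2) ψ) * hd3
  have h256 : φ 4 ^ 4 * φ (u ^ 4 / 4 ^ 4) = φ (u ^ 4) := by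
    rw [← map_pow, ← map_mul]
    congr 1
    field_simp
  have hneg : φ (-(u ^ 4)) = φ (-1) * φ (u ^ 4) := by rw [← map_mul]; congr 1; ring
  -- If `φ⁴ = 1`, one of the four characters is trivial unless `φ = ι²`.
  have hw : (if φ⁻¹ ^ 4 = 1 ∧ ∃ i,
      (![φ⁻¹, φ⁻¹ * 1, φ⁻¹ * ι, φ⁻¹ * ι ^ 3] : Fin 4 → MulChar F ℂ) i = 1
      then (Fintype.card F : ℂ) else 1) * (gaussSum (φ⁻¹ ^ 4) ψ * gaussSum (φ⁻¹ ^ 4)⁻¹ ψ) =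
      if φ = ι ^ 2 then 1 else (Fintype.card F : ℂ) := by
    by_cases hφ4 : φ ^ 4 = 1
    · have hφi : φ⁻¹ ^ 4 = 1 := by rw [inv_pow, hφ4, inv_one]
      rw [hφi, inv_one, gaussSum_one_char hψ]
      have hex : ((φ⁻¹ = 1 ∨ φ⁻¹ * 1 = 1 ∨ φ⁻¹ * ι = 1 ∨ φ⁻¹ * ι ^ 3 = 1)) ↔ ¬ φ = ι ^ 2 := by
        constructor
        · rintro h rfl
          simp only [mul_one, inv_mul_eq_one, inv_eq_one] at h
          rcases h with h | h | h | h
          · exact h2 h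
          · exact h2 h
          · have : ι = 1 := mul_left_cancel (a := ι) (by rw [← sq, h, mul_one])
            exact h2 (by rw [this, one_pow])
          · have : ι = 1 := mul_left_cancel (a := ι ^ 2) (by rw [← pow_succ, ← h, mul_one])
            exact h2 (by rw [this, one_pow])
        · intro hne
          have hφ2 : (φ ^ 2) ^ 2 = 1 := by rw [← pow_mul, hφ4]
          by_cases hs1 : φ ^ 2 = 1
          · by_cases h1 : φ = 1
            · left; simp [h1]
            · exact absurd (eq_of_sq_eq_one h1 hs1 h2 hη2) hne
          · have hs2 : φ ^ 2 = ι ^ 2 := eq_of_sq_eq_one hs1 hφ2 h2 hη2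
            right; right
            have hs3 : (φ⁻¹ * ι) ^ 2 = 1 := by rw [mul_pow, inv_pow, hs2, inv_mul_cancel]
            by_cases h1 : φ⁻¹ * ι = 1
            · left; exact h1
            · right
              have := eq_of_sq_eq_one h1 hs3 h2 hη2
              rw [pow_succ', ← mul_assoc, this, ← sq, hη2]
      have hex' : (∃ i, (![φ⁻¹, φ⁻¹ * 1, φ⁻¹ * ι, φ⁻¹ * ι ^ 3] : Fin 4 → MulChar F ℂ) i = 1) ↔
          ¬ φ = ι ^ 2 := by
        rw [← hex]
        simp [Fin.exists_fin_succ]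
      simp only [hex', true_and]
      split_ifs <;> ring
    · have hφi : φ⁻¹ ^ 4 ≠ 1 := by rwa [inv_pow, ne_eq, inv_eq_one]
      rw [gaussSum_mul_gaussSum_inv hψ hφi, if_neg (fun h => hφi h.1), if_neg]
      · rw [MulChar.pow_apply' _ (by norm_num), show 4 = 2 * 2 by rfl, pow_mul, sq (φ⁻¹ (-1)),
          MulChar.apply_neg_one_sq]
        ring
      · rintro rfl
        exact hφ4 (by rw [show 4 = 2 * 2 by rfl, pow_mul, hη2, one_pow])
  -- The exceptional weight at `φ = ι²` matches `g(φ⁻¹ ι²) = g(1) = -1`.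
  have hend : (if φ = ι ^ 2 then 1 else (Fintype.card F : ℂ)) * (gaussSum (ι ^ 2) ψ /
      gaussSum (φ⁻¹ * ι ^ 2) ψ) = φ (-1) * Fintype.card F * (gaussSum (φ * ι ^ 2) ψ /
        gaussSum (ι ^ 2) ψ) := by
    have h := card_div_gaussSum hψ (φ⁻¹ * ι ^ 2)
    have hi : (φ⁻¹ * ι ^ 2)⁻¹ = φ * ι ^ 2 := by rw [mul_inv, inv_inv, hηi]
    have hm : (φ⁻¹ * ι ^ 2) (-1) = φ (-1) := by
      rw [MulChar.mul_apply, hηm, MulChar.inv_apply']; simp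
    rw [hi, hm] at h
    by_cases hc : φ = ι ^ 2
    · subst hc
      rw [if_pos rfl, inv_mul_cancel, ← sq, hη2, hηm, gaussSum_one_char hψ, ← hs]
      field_simp
    · rw [if_neg (by rwa [inv_mul_eq_one])] at h
      rw [if_neg hc, mul_div_left_comm, h]
      field_simp
      rw [hs]
      ring
  simp only [Equiv.inv_apply, dworkTerm, hp, hG, inv_pow_four_apply φ u h40 hu]
  rw [hneg, ← h256]
  linear_combination (gaussSum φ⁻¹ ψ * φ 4 ^ 4 * ι (-1) * Fintype.card F *
        (gaussSum (ι ^ 2) ψ / gaussSum (φ⁻¹ * ι ^ 2) ψ) * φ (u ^ 4 / 4 ^ 4)) * hw +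
      (gaussSum φ⁻¹ ψ * φ 4 ^ 4 * ι (-1) * Fintype.card F * φ (u ^ 4 / 4 ^ 4)) * hend

end Contributions

/-! ### Hypergeometric sums when `4` divides `q - 1` -/

section Integral

variable {F : Type*} [Field F] [Fintype F] {ψ : AddChar F ℂ}

theorem gaussSum_half_ratio (hψ : ψ ≠ 1) (hF : ringChar F ≠ 2) {η : MulChar F ℂ} (hη : η ≠ 1)
    (hη2 : η ^ 2 = 1) (φ : MulChar F ℂ) :
    gaussSum (φ * η) ψ / gaussSum η ψ = (φ 4)⁻¹ * gaussSum (φ ^ 2) ψ / gaussSum φ ψ := by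
  rw [div_eq_div_iff (gaussSum_ne_zero hψ η) (gaussSum_ne_zero hψ φ),
    ← MulChar.inv_apply_eq_inv' φ 4]
  linear_combination gaussSum_duplication hψ hF hη hη2 φ

/-- Duplication for `φ ι` and for `φ²`, normalised by the value at `φ = 1`. -/
theorem gaussSum_quarter_ratio (hψ : ψ ≠ 1) (hF : ringChar F ≠ 2) {ι : MulChar F ℂ}
    (h2 : ι ^ 2 ≠ 1) (h4 : ι ^ 4 = 1) (φ : MulChar F ℂ) :
    gaussSum (φ * ι) ψ * gaussSum (φ * ι ^ 3) ψ / (gaussSum ι ψ * gaussSum (ι ^ 3) ψ) =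
      (φ 4 ^ 3)⁻¹ * gaussSum (φ ^ 4) ψ / gaussSum (φ ^ 2) ψ := by
  have hη2 : (ι ^ 2) ^ 2 = 1 := by rw [← pow_mul, h4]
  have h40 : (4 : F) ≠ 0 := four_cast_ne_zero hF
  have hA := gaussSum_quadruplication hψ hF h2 h4 φ
  have hA1 := gaussSum_quadruplication hψ hF h2 h4 1
  have hR := gaussSum_half_ratio hψ hF h2 hη2 (φ ^ 2)
  rw [← pow_mul, MulChar.pow_apply' _ two_ne_zero] at hR
  simp only [one_mul, inv_one, one_pow, MulChar.one_apply (isUnit_iff_ne_zero.2 h40)] at hA1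
  rw [MulChar.inv_apply_eq_inv'] at hA
  have n4 := φ.apply_ne_zero_of_ne_zero h40
  have nm := ι.apply_ne_zero_of_ne_zero (neg_ne_zero.2 (one_ne_zero (α := F)))
  have nη := gaussSum_ne_zero hψ (ι ^ 2)
  calc _ = (φ 4)⁻¹ * (gaussSum (φ ^ 2 * ι ^ 2) ψ / gaussSum (ι ^ 2) ψ) := by
        rw [hA, hA1]; field_simp
    _ = _ := by rw [hR]; field_simp

/-- A hypergeometric sum with integral `(q - 1) α = a` and `(q - 1) β = b`, as a sum over all
characters. -/
theorem hypergeometricSum_eq_sum {χ : MulChar F ℂ} (hχ : orderOf χ = Fintype.card F - 1)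
    {n : ℕ} {α β : Fin n → ℚ} (a b : Fin n → ℕ)
    (ha : ∀ i, ((Fintype.card F : ℚ) - 1) * α i = a i)
    (hb : ∀ i, ((Fintype.card F : ℚ) - 1) * β i = b i) {t : F} (ht : t ≠ 0) :
    hypergeometricSum ψ χ α β t = 1 / (1 - (Fintype.card F : ℂ)) *
      ∑ φ : MulChar F ℂ, (∏ i, gaussSum (φ * χ ^ a i) ψ * gaussSum (φ⁻¹ * (χ ^ b i)⁻¹) ψ /
        (gaussSum (χ ^ a i) ψ * gaussSum (χ ^ b i)⁻¹ ψ)) * φ ((-1) ^ n * t) := by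
  rw [hypergeometricSum, ← sum_range_mulChar_pow hχ]
  congr 1
  refine Finset.sum_congr rfl fun m _ => ?_
  have ht' : (-1) ^ n * t ≠ 0 := mul_ne_zero (pow_ne_zero _ (by simp)) ht
  rw [MulChar.pow_apply_of_ne_zero _ _ ht']
  congr 1
  refine Finset.prod_congr rfl fun i _ => ?_
  simp only [gaussG, ha, hb, Int.floor_natCast, zpow_add, zpow_sub, zpow_natCast, zpow_neg]

theorem card_sub_one_mul_one_div :
    ((Fintype.card F : ℂ) - 1) * (1 / (1 - (Fintype.card F : ℂ))) = -1 := by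
  have hq2 : (1 : ℂ) - Fintype.card F ≠ 0 := by
    rw [← neg_sub]; exact neg_ne_zero.2 card_units_ne_zero
  field_simp
  ring

section SplitQuartic

variable {χ ι : MulChar F ℂ} {e : ℕ}

theorem hypergeometricSum_half (hψ : ψ ≠ 1)
    (hχ : orderOf χ = Fintype.card F - 1) (he : Fintype.card F = 4 * e + 1)
    (hι : ι = χ ^ e) (hι4 : ι ^ 4 = 1) {t : F} (ht : t ≠ 0) :
    ((Fintype.card F : ℂ) - 1) * hypergeometricSum ψ χ ![1 / 2] ![1] t =
      ∑ φ : MulChar F ℂ, gaussSum (φ * ι ^ 2) ψ * gaussSum φ⁻¹ ψ / gaussSum (ι ^ 2) ψ *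
        φ (-t) := by
  have hc : (Fintype.card F : ℚ) - 1 = 4 * e := by rw [he]; push_cast; ring
  rw [hypergeometricSum_eq_sum hχ ![e * 2] ![e * 4]
    (by intro i; fin_cases i; simp [hc]; ring) (by intro i; fin_cases i; simp [hc]; ring) ht,
    ← mul_assoc, card_sub_one_mul_one_div, Finset.mul_sum]
  refine Finset.sum_congr rfl fun φ _ => ?_
  simp only [Fin.prod_univ_one, Matrix.cons_val_fin_one, pow_mul, ← hι, hι4, inv_one, mul_one,
    gaussSum_one_char hψ]
  rw [pow_one, neg_one_mul t]
  have := gaussSum_ne_zero hψ (ι ^ 2)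
  field_simp

theorem hypergeometricSum_quarter_threeQuarters (hψ : ψ ≠ 1) (hF : ringChar F ≠ 2)
    (hχ : orderOf χ = Fintype.card F - 1) (he : Fintype.card F = 4 * e + 1)
    (hι : ι = χ ^ e) (hι2 : ι ^ 2 ≠ 1) (hι4 : ι ^ 4 = 1) {t : F} (ht : t ≠ 0) :
    (Fintype.card F : ℂ) * ((Fintype.card F : ℂ) - 1) *
      hypergeometricSum ψ χ ![1 / 4, 3 / 4] ![1 / 2, 1] t = quadraticCharSum ψ t := by
  have hc : (Fintype.card F : ℚ) - 1 = 4 * e := by rw [he]; push_cast; ring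
  rw [hypergeometricSum_eq_sum hχ ![e, e * 3] ![e * 2, e * 4]
    (by intro i; fin_cases i <;> simp [hc] <;> ring)
    (by intro i; fin_cases i <;> simp [hc] <;> ring) ht,
    ← mul_assoc, mul_assoc (Fintype.card F : ℂ), card_sub_one_mul_one_div, Finset.mul_sum,
    quadraticCharSum]
  refine Finset.sum_congr rfl fun φ _ => ?_
  have hη2 : (ι ^ 2) ^ 2 = 1 := by rw [← pow_mul, hι4]
  have hηi : (ι ^ 2)⁻¹ = ι ^ 2 := inv_eq_of_mul_eq_one_left (by rw [← sq, hη2])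
  have h40 : (4 : F) ≠ 0 := four_cast_ne_zero hF
  have n4 := φ.apply_ne_zero_of_ne_zero h40
  have hR := gaussSum_half_ratio hψ hF hι2 hη2 φ⁻¹
  rw [MulChar.inv_apply_eq_inv', inv_inv] at hR
  have hD := card_div_gaussSum hψ (φ ^ 2)
  have hm : (φ ^ 2) (-1) = 1 := by
    rw [MulChar.pow_apply' _ two_ne_zero, sq, φ.apply_neg_one_sq]
  rw [hm, mul_one, ← inv_pow] at hD
  have ht4 : φ (t / 4 ^ 2) = φ t * ((φ 4) ^ 2)⁻¹ := φ.apply_div_pow t h40 _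
  simp only [Fin.prod_univ_two, Matrix.cons_val_zero, Matrix.cons_val_one, pow_mul, ← hι, hι4,
    inv_one, mul_one, hηi, gaussSum_one_char hψ]
  rw [neg_one_sq, one_mul]
  have n1 := gaussSum_ne_zero hψ φ⁻¹
  calc _ = Fintype.card F * ((gaussSum (φ * ι) ψ * gaussSum (φ * ι ^ 3) ψ /
          (gaussSum ι ψ * gaussSum (ι ^ 3) ψ)) *
        (gaussSum (φ⁻¹ * ι ^ 2) ψ / gaussSum (ι ^ 2) ψ) * gaussSum φ⁻¹ ψ) * φ t := by
        ring
    _ = (Fintype.card F / gaussSum (φ ^ 2) ψ) *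
          (gaussSum (φ⁻¹ ^ 2) ψ * gaussSum (φ ^ 4) ψ) * (φ t * ((φ 4) ^ 2)⁻¹) := by
        rw [gaussSum_quarter_ratio hψ hF hι2 hι4, hR]
        field_simp
    _ = _ := by rw [hD, ht4]; ring

theorem hypergeometricSum_quarter_half_threeQuarters (hψ : ψ ≠ 1) (hF : ringChar F ≠ 2)
    (hχ : orderOf χ = Fintype.card F - 1) (he : Fintype.card F = 4 * e + 1)
    (hι : ι = χ ^ e) (hι2 : ι ^ 2 ≠ 1) (hι4 : ι ^ 4 = 1) {t : F} (ht : t ≠ 0) :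
    (Fintype.card F : ℂ) * ((Fintype.card F : ℂ) - 1) *
      hypergeometricSum ψ χ ![1 / 4, 2 / 4, 3 / 4] ![1, 1, 1] t = quarticCharSum ψ t := by
  have hc : (Fintype.card F : ℚ) - 1 = 4 * e := by rw [he]; push_cast; ring
  rw [hypergeometricSum_eq_sum hχ ![e, e * 2, e * 3] ![e * 4, e * 4, e * 4]
    (by intro i; fin_cases i <;> simp [hc] <;> ring)
    (by intro i; fin_cases i <;> simp [hc] <;> ring) ht,
    ← mul_assoc, mul_assoc (Fintype.card F : ℂ), card_sub_one_mul_one_div, Finset.mul_sum,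
    quarticCharSum]
  refine Finset.sum_congr rfl fun φ _ => ?_
  have hη2 : (ι ^ 2) ^ 2 = 1 := by rw [← pow_mul, hι4]
  have h40 : (4 : F) ≠ 0 := four_cast_ne_zero hF
  have n4 := φ.apply_ne_zero_of_ne_zero h40
  have hD := card_div_gaussSum hψ φ
  have ht4 : φ (t / 4 ^ 4) = φ t * ((φ 4) ^ 4)⁻¹ := φ.apply_div_pow t h40 _
  have hneg : φ ((-1) ^ 3 * t) = φ (-1) * φ t := by rw [← map_mul]; congr 1; ring
  simp only [Fin.prod_univ_three, Matrix.cons_val, pow_mul, ← hι, hι4,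
    inv_one, mul_one, gaussSum_one_char hψ]
  rw [hneg]
  have n2 := gaussSum_ne_zero hψ (φ ^ 2)
  calc _ = Fintype.card F * ((gaussSum (φ * ι) ψ * gaussSum (φ * ι ^ 3) ψ /
          (gaussSum ι ψ * gaussSum (ι ^ 3) ψ)) *
        (gaussSum (φ * ι ^ 2) ψ / gaussSum (ι ^ 2) ψ) * gaussSum φ⁻¹ ψ ^ 3) *
          (φ (-1) * φ t) := by
        ring
    _ = (Fintype.card F / gaussSum φ ψ) * gaussSum φ⁻¹ ψ ^ 3 * gaussSum (φ ^ 4) ψ *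
          (φ (-1) * φ t * ((φ 4) ^ 4)⁻¹) := by
        rw [gaussSum_quarter_ratio hψ hF hι2 hι4, gaussSum_half_ratio hψ hF hι2 hη2]
        field_simp
    _ = _ := by
        rw [hD, ht4]
        linear_combination ((if φ = 1 then (Fintype.card F : ℂ) else 1) * gaussSum φ⁻¹ ψ ^ 4 *
          gaussSum (φ ^ 4) ψ * φ t * ((φ 4) ^ 4)⁻¹) * φ.apply_neg_one_sq

end SplitQuartic

end Integral

/-! ### Independence of the choice of `γ` -/

/-- The polynomial `∏_{n ∈ M} (Tⁿ - 1)` attached to a multiset `M` of exponents. -/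
def cyclotomicProd (M : Multiset ℕ) : Polynomial ℂ := (M.map fun n => Polynomial.X ^ n - 1).prod

theorem cyclotomicProd_add (M N : Multiset ℕ) :
    cyclotomicProd (M + N) = cyclotomicProd M * cyclotomicProd N := by
  simp [cyclotomicProd]

theorem X_pow_sub_one_ne_zero_of_pos {n : ℕ} (hn : 0 < n) :
    (Polynomial.X ^ n - 1 : Polynomial ℂ) ≠ 0 := by
  simpa using Polynomial.X_pow_sub_C_ne_zero hn (1 : ℂ)

theorem cyclotomicProd_ne_zero {M : Multiset ℕ} (hM : ∀ n ∈ M, 0 < n) : cyclotomicProd M ≠ 0 := by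
  refine Multiset.prod_ne_zero fun h => ?_
  obtain ⟨n, hn, h0⟩ := Multiset.mem_map.1 h
  exact X_pow_sub_one_ne_zero_of_pos (hM n hn) h0

theorem rootMultiplicity_X_pow_sub_one {n : ℕ} (hn : 0 < n) (ζ : ℂ) :
    (Polynomial.X ^ n - 1 : Polynomial ℂ).rootMultiplicity ζ = if ζ ^ n = 1 then 1 else 0 := by
  have hnd : (Polynomial.X ^ n - 1 : Polynomial ℂ).roots.Nodup :=
    Polynomial.nodup_roots (Polynomial.separable_X_pow_sub_C (1 : ℂ)
      (by exact_mod_cast hn.ne') one_ne_zero)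
  rw [← Polynomial.count_roots, Multiset.count_eq_of_nodup hnd]
  congr 1
  rw [Polynomial.mem_roots (X_pow_sub_one_ne_zero_of_pos hn)]
  simp [sub_eq_zero]

theorem rootMultiplicity_cyclotomicProd {M : Multiset ℕ} (hM : ∀ n ∈ M, 0 < n) (ζ : ℂ) :
    (cyclotomicProd M).rootMultiplicity ζ = M.countP fun n => ζ ^ n = 1 := by
  induction M using Multiset.induction_on with
  | empty => simp [cyclotomicProd, Polynomial.rootMultiplicity_eq_zero]
  | cons n M ih =>
    have hn := hM n (Multiset.mem_cons_self n M)
    have hM' : ∀ m ∈ M, 0 < m := fun m hm => hM m (Multiset.mem_cons_of_mem hm)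
    have : cyclotomicProd (n ::ₘ M) = (Polynomial.X ^ n - 1) * cyclotomicProd M := by
      simp [cyclotomicProd]
    rw [this, Polynomial.rootMultiplicity_mul
      (mul_ne_zero (X_pow_sub_one_ne_zero_of_pos hn) (cyclotomicProd_ne_zero hM')),
      rootMultiplicity_X_pow_sub_one hn, ih hM', Multiset.countP_cons, add_comm]

theorem rootMultiplicity_gcd {p r : Polynomial ℂ} (hp : p ≠ 0) (hr : r ≠ 0) (ζ : ℂ) :
    (EuclideanDomain.gcd p r).rootMultiplicity ζ =
      min (p.rootMultiplicity ζ) (r.rootMultiplicity ζ) := by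
  have hg : EuclideanDomain.gcd p r ≠ 0 := fun h => hp (EuclideanDomain.gcd_eq_zero_iff.1 h).1
  refine eq_of_forall_le_iff fun n => ?_
  rw [le_min_iff, Polynomial.le_rootMultiplicity_iff hg, Polynomial.le_rootMultiplicity_iff hp,
    Polynomial.le_rootMultiplicity_iff hr]
  exact ⟨fun h => ⟨h.trans (EuclideanDomain.gcd_dvd_left p r),
    h.trans (EuclideanDomain.gcd_dvd_right p r)⟩, fun h => EuclideanDomain.dvd_gcd h.1 h.2⟩

/-- A multiset of positive integers is determined by the numbers of multiples of each `d`
that it contains: the largest element is a multiple of itself in both multisets, and can be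
removed from both. -/
theorem multiset_eq_of_countP_dvd {M N : Multiset ℕ} (hM : ∀ n ∈ M, 0 < n) (hN : ∀ n ∈ N, 0 < n)
    (h : ∀ d, 0 < d → M.countP (d ∣ ·) = N.countP (d ∣ ·)) : M = N := by
  induction hc : Multiset.card M generalizing M N with
  | zero =>
    rw [Multiset.card_eq_zero] at hc
    subst hc
    symm
    rw [← Multiset.card_eq_zero]
    have := h 1 one_pos
    simpa using this.symm
  | succ c ih =>
    have hne : (M + N).toFinset.Nonempty := by
      obtain ⟨n, hn⟩ := Multiset.card_pos_iff_exists_mem.1 (by omega : 0 < Multiset.card M)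
      exact ⟨n, by simp [hn]⟩
    have hkey : ∀ {A B : Multiset ℕ} {d : ℕ}, (∀ n ∈ B, 0 < n) →
        A.countP (d ∣ ·) = B.countP (d ∣ ·) → (∀ n ∈ B, n ≤ d) → d ∈ A → d ∈ B := by
      intro A B d hB hAB hle hd
      have : 0 < B.countP (d ∣ ·) := hAB ▸ Multiset.countP_pos.2 ⟨d, hd, dvd_rfl⟩
      obtain ⟨n, hn, hdn⟩ := Multiset.countP_pos.1 this
      rwa [le_antisymm (Nat.le_of_dvd (hB n hn) hdn) (hle n hn)]
    obtain ⟨d, hmem, hle⟩ : ∃ d ∈ M + N, ∀ n ∈ M + N, n ≤ d :=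
      ⟨_, Multiset.mem_toFinset.1 (Finset.max'_mem _ hne), fun n hn =>
        Finset.le_max' _ _ (Multiset.mem_toFinset.2 hn)⟩
    have hleM : ∀ n ∈ M, n ≤ d := fun n hn => hle n (Multiset.mem_add.2 (Or.inl hn))
    have hleN : ∀ n ∈ N, n ≤ d := fun n hn => hle n (Multiset.mem_add.2 (Or.inr hn))
    have hd0 : 0 < d := (Multiset.mem_add.1 hmem).elim (hM d) (hN d)
    have hdMN : d ∈ M ∧ d ∈ N := by
      rcases Multiset.mem_add.1 hmem with h1 | h1
      · exact ⟨h1, hkey hN (h d hd0) hleN h1⟩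
      · exact ⟨hkey hM (h d hd0).symm hleM h1, h1⟩
    obtain ⟨M', rfl⟩ := Multiset.exists_cons_of_mem hdMN.1
    obtain ⟨N', rfl⟩ := Multiset.exists_cons_of_mem hdMN.2
    rw [ih (M := M') (N := N') (fun n hn => hM n (Multiset.mem_cons_of_mem hn))
      (fun n hn => hN n (Multiset.mem_cons_of_mem hn)) (fun e he => ?_) (by simpa using hc)]
    have := h e he
    rw [Multiset.countP_cons, Multiset.countP_cons] at this
    exact Nat.add_right_cancel this

/-- The multiplicity of a primitive `d`-th root of unity counts the multiples of `d`. -/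
theorem cyclotomicProd_injective {M N : Multiset ℕ} (hM : ∀ n ∈ M, 0 < n) (hN : ∀ n ∈ N, 0 < n)
    (h : cyclotomicProd M = cyclotomicProd N) : M = N := by
  refine multiset_eq_of_countP_dvd hM hN fun d hd => ?_
  have hζ := Complex.isPrimitiveRoot_exp d hd.ne'
  have h1 := rootMultiplicity_cyclotomicProd hM (Complex.exp (2 * Real.pi * Complex.I / d))
  rw [h, rootMultiplicity_cyclotomicProd hN] at h1
  simp only [hζ.pow_eq_one_iff_dvd] at h1
  exact h1.symm

section Gamma

variable {k l n : ℕ}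

/-- The positive entries of `γ`, as a multiset. -/
def gammaPos (γ : Fin k → ℤ) : Multiset ℕ :=
  (univ.filter fun j => 0 < γ j).val.map fun j => (γ j).natAbs

/-- The absolute values of the negative entries of `γ`, as a multiset. -/
def gammaNeg (γ : Fin k → ℤ) : Multiset ℕ :=
  (univ.filter fun j => γ j < 0).val.map fun j => (γ j).natAbs

theorem pos_of_mem_gammaPos {γ : Fin k → ℤ} {n : ℕ} (hn : n ∈ gammaPos γ) : 0 < n := by
  obtain ⟨j, hj, rfl⟩ := Multiset.mem_map.1 hn
  have : 0 < γ j := by simpa using hj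
  omega

theorem pos_of_mem_gammaNeg {γ : Fin k → ℤ} {n : ℕ} (hn : n ∈ gammaNeg γ) : 0 < n := by
  obtain ⟨j, hj, rfl⟩ := Multiset.mem_map.1 hn
  have : γ j < 0 := by simpa using hj
  omega

theorem gammaNum_eq (γ : Fin k → ℤ) : gammaNum γ = cyclotomicProd (gammaNeg γ) := by
  simp only [gammaNum, cyclotomicProd, gammaNeg, Multiset.map_map, Finset.prod]
  rfl

theorem gammaDen_eq (γ : Fin k → ℤ) : gammaDen γ = cyclotomicProd (gammaPos γ) := by
  simp only [gammaDen, cyclotomicProd, gammaPos, Multiset.map_map, Finset.prod]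
  rfl

theorem paramPoly_ne_zero (α : Fin n → ℚ) : paramPoly α ≠ 0 :=
  Finset.prod_ne_zero_iff.2 fun _ _ => Polynomial.X_sub_C_ne_zero _

/-- Two vectors that represent the same parameters agree up to cancelling pairs `(m, -m)`. -/
theorem gammaNeg_add_gammaPos {γ : Fin k → ℤ} {γ' : Fin l → ℤ} {α β : Fin n → ℚ}
    (h : GammaRepresents γ α β) (h' : GammaRepresents γ' α β) :
    gammaNeg γ + gammaPos γ' = gammaNeg γ' + gammaPos γ := by
  refine cyclotomicProd_injective ?_ ?_ ?_
  · intro m hm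
    exact (Multiset.mem_add.1 hm).elim pos_of_mem_gammaNeg pos_of_mem_gammaPos
  · intro m hm
    exact (Multiset.mem_add.1 hm).elim pos_of_mem_gammaNeg pos_of_mem_gammaPos
  · rw [cyclotomicProd_add, cyclotomicProd_add, ← gammaNum_eq, ← gammaNum_eq, ← gammaDen_eq,
      ← gammaDen_eq]
    apply mul_left_cancel₀ (paramPoly_ne_zero β)
    linear_combination (-gammaDen γ') * h.2 + gammaDen γ * h'.2

theorem prod_eq_gammaPos_mul_gammaNeg {γ : Fin k → ℤ} (hγ : ∀ j, γ j ≠ 0) (f : ℤ → ℂ) :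
    ∏ j, f (γ j) = ((gammaPos γ).map fun n : ℕ => f n).prod *
      ((gammaNeg γ).map fun n : ℕ => f (-n)).prod := by
  rw [← Finset.prod_filter_mul_prod_filter_not univ (fun j => 0 < γ j)]
  simp only [gammaPos, gammaNeg, Multiset.map_map]
  congr 1
  · change _ = ∏ j with 0 < γ j, f ((γ j).natAbs : ℤ)
    refine Finset.prod_congr rfl fun j hj => ?_
    rw [Int.natAbs_of_nonneg (mem_filter.1 hj).2.le]
  · change _ = ∏ j with γ j < 0, f (-((γ j).natAbs : ℤ))
    refine Finset.prod_congr (Finset.filter_congr fun j _ => ?_) fun j hj => ?_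
    · have := hγ j; omega
    · have := (mem_filter.1 hj).2
      congr 1; omega

variable {F : Type*} [Field F] [Fintype F] {ψ : AddChar F ℂ}

/-- The multiplicity `s(m)` in terms of the character `φ = χᵐ`: a power `Tⁿ - 1` vanishes at
`e^{2πim/(q-1)}` exactly if `φⁿ = 1`. -/
def charMult (γ : Fin k → ℤ) (φ : MulChar F ℂ) : ℕ :=
  min ((gammaNeg γ).countP fun n => φ ^ n = 1) ((gammaPos γ).countP fun n => φ ^ n = 1)

theorem gammaMult_eq_charMult {χ : MulChar F ℂ} (hχ : orderOf χ = Fintype.card F - 1)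
    (γ : Fin k → ℤ) (m : ℕ) : gammaMult (Fintype.card F) γ m = charMult γ (χ ^ m) := by
  have hc : 1 < Fintype.card F := Fintype.one_lt_card
  have hN : Fintype.card F - 1 ≠ 0 := by omega
  have hζ := Complex.isPrimitiveRoot_exp _ hN
  have hexp : Complex.exp (2 * Real.pi * Complex.I * ((m : ℤ) : ℂ) / ((Fintype.card F : ℂ) - 1)) =
      Complex.exp (2 * Real.pi * Complex.I / ((Fintype.card F - 1 : ℕ) : ℂ)) ^ m := by
    rw [← Complex.exp_nat_mul, Nat.cast_sub hc.le]
    congr 1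
    push_cast
    ring
  have hiff : ∀ n : ℕ,
      (Complex.exp (2 * Real.pi * Complex.I / ((Fintype.card F - 1 : ℕ) : ℂ)) ^ m) ^ n = 1 ↔
        (χ ^ m) ^ n = 1 := by
    intro n
    rw [← pow_mul, ← pow_mul, hζ.pow_eq_one_iff_dvd, ← orderOf_dvd_iff_pow_eq_one, hχ]
  rw [gammaMult, hexp, gammaNum_eq, gammaDen_eq,
    rootMultiplicity_gcd (cyclotomicProd_ne_zero fun _ => pos_of_mem_gammaNeg)
      (cyclotomicProd_ne_zero fun _ => pos_of_mem_gammaPos),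
    rootMultiplicity_cyclotomicProd fun _ => pos_of_mem_gammaNeg,
    rootMultiplicity_cyclotomicProd fun _ => pos_of_mem_gammaPos]
  simp only [hiff, charMult]

theorem intCast_ne_zero_of_coprime {a : ℤ} (h : Nat.Coprime (Fintype.card F) a.natAbs) :
    (a : F) ≠ 0 := by
  intro h0
  have hp := CharP.char_ne_one F (ringChar F)
  have h1 : ringChar F ∣ a.natAbs := by
    rw [← Int.natCast_dvd]; exact (CharP.intCast_eq_zero_iff F (ringChar F) a).1 h0
  have h2 : ringChar F ∣ Fintype.card F := ringChar.dvd (Nat.cast_card_eq_zero F)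
  exact hp (Nat.dvd_one.1 (h ▸ Nat.dvd_gcd h2 h1))

/-- The hypergeometric sum of `γ` as a sum over all characters, with the sign `(-1)^k` and the value
at `γ^γ` distributed over the entries of `γ`. -/
theorem gammaHypergeometricSum_eq_sum {χ : MulChar F ℂ} (hχ : orderOf χ = Fintype.card F - 1)
    {γ : Fin k → ℤ} (hγ : ∀ j, (γ j : F) ≠ 0) {t : F} (ht : t ≠ 0) :
    gammaHypergeometricSum ψ χ γ t = 1 / (1 - (Fintype.card F : ℂ)) *
      ∑ φ : MulChar F ℂ, (∏ j, -(gaussSum (φ ^ (-γ j)) ψ * φ (γ j) ^ γ j)) *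
        (Fintype.card F : ℂ) ^ ((charMult γ φ : ℤ) - charMult γ (1 : MulChar F ℂ)) * φ t := by
  rw [gammaHypergeometricSum, ← sum_range_mulChar_pow hχ, div_eq_mul_one_div,
    mul_comm ((-1) ^ k : ℂ), mul_assoc, Finset.mul_sum]
  congr 1
  refine Finset.sum_congr rfl fun m _ => ?_
  have h0 : gammaMult (Fintype.card F) γ 0 = charMult γ (1 : MulChar F ℂ) := by
    simpa using gammaMult_eq_charMult hχ γ 0
  have hpr : (∏ j : Fin k, (γ j : F) ^ γ j) ≠ 0 :=
    Finset.prod_ne_zero_iff.2 fun j _ => zpow_ne_zero _ (hγ j)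
  have hval : ∀ (φ : MulChar F ℂ), φ (∏ j : Fin k, (γ j : F) ^ γ j) = ∏ j, φ (γ j) ^ γ j := by
    intro φ
    rw [map_prod]
    exact Finset.prod_congr rfl fun j _ => map_zpow₀ φ.toMonoidWithZeroHom _ _
  rw [gammaMult_eq_charMult hχ, h0, ← MulChar.pow_apply_of_ne_zero _ _ (mul_ne_zero hpr ht),
    map_mul, hval, Finset.prod_neg, Finset.card_univ, Fintype.card_fin, Finset.prod_mul_distrib]
  have hG : ∀ j, gaussG ψ χ (-γ j * (m : ℤ)) = gaussSum ((χ ^ m) ^ (-γ j)) ψ := by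
    intro j
    rw [gaussG, mul_comm, zpow_mul, zpow_natCast]
  simp only [hG]
  ring

/-- The factor of an entry `a` of `γ` in the summand of `φ`, normalised by `q⁻¹` for `a > 0` and
`φ^a ≠ 1`, so that the factors of `a` and `-a` are inverse to each other. -/
def gammaFactor (ψ : AddChar F ℂ) (φ : MulChar F ℂ) (a : ℤ) : ℂ :=
  -(gaussSum (φ ^ (-a)) ψ * φ (a : F) ^ a) *
    (if 0 < a ∧ φ ^ a ≠ 1 then (Fintype.card F : ℂ)⁻¹ else 1)

theorem gammaFactor_mul_neg (hψ : ψ ≠ 1) (φ : MulChar F ℂ) {m : ℕ} (hm : 0 < m)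
    (hm' : (m : F) ≠ 0) : gammaFactor ψ φ m * gammaFactor ψ φ (-m) = 1 := by
  have hneg : φ ((-(m : ℤ) : ℤ) : F) = φ (-1) * φ m := by
    rw [← map_mul]; push_cast; congr 1; ring
  have h1 := φ.apply_ne_zero_of_ne_zero hm'
  have h2 : φ (-1) ≠ 0 := φ.apply_ne_zero_of_ne_zero (by simp)
  have hq := card_field_ne_zero (F := F)
  rw [gammaFactor, gammaFactor, hneg]
  simp only [neg_neg, zpow_neg, zpow_natCast, Nat.cast_pos, hm, true_and, Int.cast_natCast,
    Left.neg_pos_iff]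
  have hlt : ¬ ((m : ℤ) < 0 ∧ (φ ^ m)⁻¹ ≠ 1) := by omega
  rw [if_neg hlt, mul_pow]
  by_cases h : φ ^ m = 1
  · have h3 : φ (-1) ^ m = 1 := by
      rw [← MulChar.pow_apply_of_ne_zero φ m (neg_ne_zero.2 one_ne_zero), h,
        MulChar.one_apply (by simp)]
    simp only [h, h3, inv_one, gaussSum_one_char hψ, ne_eq, not_true, if_false]
    field_simp
  · have h4 := gaussSum_mul_gaussSum_inv hψ h
    rw [MulChar.pow_apply_of_ne_zero φ m (neg_ne_zero.2 one_ne_zero)] at h4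
    simp only [ne_eq, h, not_false_eq_true, if_true]
    field_simp
    linear_combination h4

theorem prod_gammaFactor {γ : Fin k → ℤ} (hγ : ∀ j, γ j ≠ 0) (φ : MulChar F ℂ) :
    ∏ j, gammaFactor ψ φ (γ j) =
      (∏ j, -(gaussSum (φ ^ (-γ j)) ψ * φ (γ j) ^ γ j)) *
        (Fintype.card F : ℂ) ^ (((gammaPos γ).countP fun n => φ ^ n = 1 : ℤ) -
          ((gammaPos γ).countP fun n => (1 : MulChar F ℂ) ^ n = 1)) := by
  have hq := card_field_ne_zero (F := F)
  simp only [gammaFactor]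
  rw [Finset.prod_mul_distrib]
  congr 1
  rw [prod_eq_gammaPos_mul_gammaNeg hγ
    (fun a => if 0 < a ∧ φ ^ a ≠ 1 then (Fintype.card F : ℂ)⁻¹ else 1)]
  have hneg : ((gammaNeg γ).map fun n : ℕ =>
      if 0 < -(n : ℤ) ∧ φ ^ (-(n : ℤ)) ≠ 1 then (Fintype.card F : ℂ)⁻¹ else 1).prod = 1 := by
    refine Multiset.prod_eq_one fun x hx => ?_
    obtain ⟨m, hm, rfl⟩ := Multiset.mem_map.1 hx
    rw [if_neg (by omega)]
  rw [hneg, mul_one]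
  have hgen : ∀ M : Multiset ℕ, (∀ n ∈ M, 0 < n) → (M.map fun n : ℕ =>
      if 0 < (n : ℤ) ∧ φ ^ (n : ℤ) ≠ 1 then (Fintype.card F : ℂ)⁻¹ else 1).prod =
      (Fintype.card F : ℂ) ^ ((M.countP fun n => φ ^ n = 1 : ℤ) -
          (M.countP fun n => (1 : MulChar F ℂ) ^ n = 1)) := by
    intro M
    induction M using Multiset.induction_on with
    | empty => simp
    | cons n M ih =>
      intro hM
      have hn := hM n (Multiset.mem_cons_self n M)
      rw [Multiset.map_cons, Multiset.prod_cons, ih fun m hm => hM m (Multiset.mem_cons_of_mem hm),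
        Multiset.countP_cons, Multiset.countP_cons]
      simp only [Nat.cast_pos, hn, true_and, zpow_natCast, one_pow, if_true]
      by_cases h : φ ^ n = 1
      · simp [h]
      · simp only [ne_eq, h, not_false_eq_true, if_true, if_false]
        rw [← zpow_neg_one, ← zpow_add₀ hq]
        congr 1
        push_cast
        ring
  exact hgen _ fun _ => pos_of_mem_gammaPos

/-- The hypergeometric sum of `γ` depends only on the parameters that `γ` represents: cancelling a
pair `(m, -m)` in `γ` changes neither the product of the factors nor the remaining power of `q`. -/
theorem gammaHypergeometricSum_congr (hψ : ψ ≠ 1) {χ : MulChar F ℂ}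
    (hχ : orderOf χ = Fintype.card F - 1) {γ : Fin k → ℤ} {γ' : Fin l → ℤ} {α β : Fin n → ℚ}
    (h : GammaRepresents γ α β) (h' : GammaRepresents γ' α β)
    (hγ : ∀ j, (γ j : F) ≠ 0) (hγ' : ∀ j, (γ' j : F) ≠ 0) {t : F} (ht : t ≠ 0) :
    gammaHypergeometricSum ψ χ γ t = gammaHypergeometricSum ψ χ γ' t := by
  have hq := card_field_ne_zero (F := F)
  have hM := gammaNeg_add_gammaPos h h'
  rw [gammaHypergeometricSum_eq_sum hχ hγ ht, gammaHypergeometricSum_eq_sum hχ hγ' ht]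
  congr 1
  refine Finset.sum_congr rfl fun φ _ => ?_
  congr 1
  have hcount : ∀ φ : MulChar F ℂ,
      (gammaNeg γ).countP (fun n => φ ^ n = 1) + (gammaPos γ').countP (fun n => φ ^ n = 1) =
      (gammaNeg γ').countP (fun n => φ ^ n = 1) + (gammaPos γ).countP (fun n => φ ^ n = 1) := by
    intro φ
    rw [← Multiset.countP_add, hM, Multiset.countP_add]
  have hinv : ∀ {i : ℕ} {δ : Fin i → ℤ}, (∀ j, (δ j : F) ≠ 0) →
      ((gammaNeg δ).map fun n : ℕ => gammaFactor ψ φ (-n)).prod *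
        ((gammaNeg δ).map fun n : ℕ => gammaFactor ψ φ n).prod = 1 := by
    intro i δ hδ
    rw [← Multiset.prod_map_mul]
    refine Multiset.prod_eq_one fun x hx => ?_
    obtain ⟨m, hm, rfl⟩ := Multiset.mem_map.1 hx
    rw [mul_comm]
    refine gammaFactor_mul_neg hψ φ (pos_of_mem_gammaNeg hm) ?_
    obtain ⟨j, hj, rfl⟩ := Multiset.mem_map.1 hm
    rw [← Int.cast_natCast]
    rcases Int.natAbs_eq (δ j) with h | h
    · rw [← h]; exact hδ j
    · rw [show ((δ j).natAbs : ℤ) = -δ j by omega, Int.cast_neg]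
      exact neg_ne_zero.2 (hδ j)
  have hprod : ∏ j, gammaFactor ψ φ (γ j) = ∏ j, gammaFactor ψ φ (γ' j) := by
    have e := congrArg (fun M : Multiset ℕ => (M.map fun n : ℕ => gammaFactor ψ φ n).prod) hM
    simp only [Multiset.map_add, Multiset.prod_add] at e
    have i1 := hinv hγ
    have i2 := hinv hγ'
    rw [prod_eq_gammaPos_mul_gammaNeg h.1, prod_eq_gammaPos_mul_gammaNeg h'.1]
    apply mul_right_cancel₀ (mul_ne_zero (right_ne_zero_of_mul_eq_one i1)
      (right_ne_zero_of_mul_eq_one i2))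
    linear_combination (((gammaPos γ).map fun n : ℕ => gammaFactor ψ φ n).prod *
        ((gammaNeg γ').map fun n : ℕ => gammaFactor ψ φ n).prod) * i1 -
      (((gammaPos γ').map fun n : ℕ => gammaFactor ψ φ n).prod *
        ((gammaNeg γ).map fun n : ℕ => gammaFactor ψ φ n).prod) * i2 - e
  rw [prod_gammaFactor h.1, prod_gammaFactor h'.1] at hprod
  have c1 := hcount φ
  have c2 := hcount 1
  -- The power of `q` left over by the normalisation depends only on the difference of the numbers
  -- of negative and positive entries `a` with `φ^a = 1`, which is the same for `γ` and `γ'`.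
  obtain ⟨D, hD, hD'⟩ : ∃ D : ℤ,
      ((charMult γ φ : ℤ) - charMult γ (1 : MulChar F ℂ) =
        (((gammaPos γ).countP fun n => φ ^ n = 1 : ℤ) -
          ((gammaPos γ).countP fun n => (1 : MulChar F ℂ) ^ n = 1)) + D) ∧
      ((charMult γ' φ : ℤ) - charMult γ' (1 : MulChar F ℂ) =
        (((gammaPos γ').countP fun n => φ ^ n = 1 : ℤ) -
          ((gammaPos γ').countP fun n => (1 : MulChar F ℂ) ^ n = 1)) + D) := by
    refine ⟨_, (add_sub_cancel _ _).symm, ?_⟩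
    simp only [charMult]
    omega
  rw [hD, hD', zpow_add₀ hq, zpow_add₀ hq, ← mul_assoc, ← mul_assoc, hprod]

end Gamma

/-! ### The number of points -/

section Count

variable {F : Type*} [Field F] [Fintype F] {ψ : AddChar F ℂ} {χ : MulChar F ℂ}

theorem gammaHypergeometricSum_quartic (hF : ringChar F ≠ 2)
    (hχ : orderOf χ = Fintype.card F - 1) {t : F} (ht : t ≠ 0) :
    (Fintype.card F : ℂ) * ((Fintype.card F : ℂ) - 1) *
      gammaHypergeometricSum ψ χ ![-4, 1, 1, 1, 1] t = quarticCharSum ψ t := by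
  have h40 : (4 : F) ≠ 0 := four_cast_ne_zero hF
  rw [gammaHypergeometricSum_eq_sum hχ (by intro j; fin_cases j <;> simp [h40]) ht, ← mul_assoc,
    mul_assoc (Fintype.card F : ℂ), card_sub_one_mul_one_div, Finset.mul_sum, quarticCharSum]
  refine Finset.sum_congr rfl fun φ _ => ?_
  have hq := card_field_ne_zero (F := F)
  have n4 := φ.apply_ne_zero_of_ne_zero h40
  have hneg : gammaNeg ![-4, 1, 1, 1, 1] = {4} := by decide
  have hpos : gammaPos ![-4, 1, 1, 1, 1] = {1, 1, 1, 1} := by decide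
  have hmult : ∀ φ : MulChar F ℂ, charMult ![-4, 1, 1, 1, 1] φ = if φ = 1 then 1 else 0 := by
    intro φ
    rw [charMult, hneg, hpos]
    by_cases h : φ = 1
    · subst h; simp [← Multiset.cons_zero]
    · simp [h, ← Multiset.cons_zero]
  have hφ4 := φ.apply_neg_four_zpow
  have ht4 : φ (t / 4 ^ 4) = φ t * ((φ 4) ^ 4)⁻¹ := φ.apply_div_pow t h40 _
  have hz : φ ^ (4 : ℤ) = φ ^ 4 := zpow_natCast φ 4
  rw [hmult, hmult, if_pos rfl, ht4]
  simp only [Fin.prod_univ_five, Matrix.cons_val, hz, Int.cast_neg, Int.cast_ofNat,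
    Int.cast_one, hφ4, zpow_neg, zpow_one, map_one, mul_one]
  split_ifs with h
  · simp; ring
  · simp
    field_simp

theorem gammaHypergeometricSum_quadratic (hF : ringChar F ≠ 2)
    (hχ : orderOf χ = Fintype.card F - 1) {t : F} (ht : t ≠ 0) :
    (Fintype.card F : ℂ) * ((Fintype.card F : ℂ) - 1) *
      gammaHypergeometricSum ψ χ ![-4, 2, 2] t = quadraticCharSum ψ t := by
  have h20 : (2 : F) ≠ 0 := Ring.two_ne_zero hF
  have h40 : (4 : F) ≠ 0 := four_cast_ne_zero hF
  rw [gammaHypergeometricSum_eq_sum hχ (by intro j; fin_cases j <;> simp [h40, h20]) ht,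
    ← mul_assoc, mul_assoc (Fintype.card F : ℂ), card_sub_one_mul_one_div, Finset.mul_sum,
    quadraticCharSum]
  refine Finset.sum_congr rfl fun φ _ => ?_
  have hq := card_field_ne_zero (F := F)
  have n4 := φ.apply_ne_zero_of_ne_zero h40
  have hneg : gammaNeg ![-4, 2, 2] = {4} := by decide
  have hpos : gammaPos ![-4, 2, 2] = {2, 2} := by decide
  have hmult : ∀ φ : MulChar F ℂ, charMult ![-4, 2, 2] φ = if φ ^ 2 = 1 then 1 else 0 := by
    intro φ
    rw [charMult, hneg, hpos]
    by_cases h : φ ^ 2 = 1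
    · have h4 : φ ^ 4 = 1 := by rw [show 4 = 2 * 2 by rfl, pow_mul, h, one_pow]
      simp [h, h4, ← Multiset.cons_zero]
    · simp [h, ← Multiset.cons_zero]
  have hφ4 := φ.apply_neg_four_zpow
  have hφ2 : φ 2 ^ (2 : ℤ) = φ 4 := by
    rw [show (2 : ℤ) = ((2 : ℕ) : ℤ) by rfl, zpow_natCast, ← map_pow]
    congr 1
    norm_num
  have ht4 : φ (t / 4 ^ 2) = φ t * ((φ 4) ^ 2)⁻¹ := φ.apply_div_pow t h40 _
  have hz : φ ^ (4 : ℤ) = φ ^ 4 := zpow_natCast φ 4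
  have hz2 : φ ^ (2 : ℤ) = φ ^ 2 := zpow_natCast φ 2
  rw [hmult, hmult, one_pow, if_pos rfl, ht4]
  simp only [Fin.prod_univ_three, Matrix.cons_val, hz, Int.cast_neg, Int.cast_ofNat,
    hφ4, hφ2, zpow_neg, hz2, ← inv_pow φ]
  split_ifs with h
  · simp
    field_simp
  · simp
    field_simp

theorem ringChar_ne_two_of_odd_card (h : Fintype.card F % 2 = 1) : ringChar F ≠ 2 := by
  intro h2
  have := FiniteField.even_card_of_char_two h2
  omega

/-- The number of points of the surface in terms of the contributions of the quadruples. -/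
theorem card_mul_ncard_dworkPoints (hψ : ψ ≠ 1) {u : F} (h4 : (4 : F) ≠ 0) (hu : u ≠ 0) :
    (Fintype.card F : ℂ) * (((Fintype.card F : ℂ) - 1) * (dworkPoints u).ncard + 1) =
      (Fintype.card F : ℂ) ^ 4 + ∑ Θ : Fin 4 → MulChar F ℂ,
        if ∀ i, Θ i ^ 4 = ∏ j, Θ j then dworkTerm ψ (4 * u⁻¹) Θ else 0 := by
  have h := card_mul_card_affine_dwork hψ (Units.mk0 (4 * u⁻¹) (mul_ne_zero h4 (inv_ne_zero hu)))
  rw [Units.val_mk0, ← ncard_dworkPoints] at h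
  rw [← h]
  push_cast [Nat.cast_sub (Fintype.card_pos (α := F))]
  ring

theorem ncard_dworkPoints_of_mod_three (hψ : ψ ≠ 1) (hχ : orderOf χ = Fintype.card F - 1)
    {u : F} (hu : u ≠ 0) (hq : Fintype.card F % 4 = 3) :
    ((dworkPoints u).ncard : ℂ) =
      (Fintype.card F : ℂ) ^ 2 + (Fintype.card F : ℂ) + 1
        + gammaHypergeometricSum ψ χ ![-4, 1, 1, 1, 1] (u ^ 4)
        - 3 * (Fintype.card F : ℂ) * gammaHypergeometricSum ψ χ ![-4, 2, 2] (u ^ 4) := by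
  have hF : ringChar F ≠ 2 := ringChar_ne_two_of_odd_card (by omega)
  have h4 := four_cast_ne_zero hF
  set η := χ ^ ((Fintype.card F - 1) / 2) with hη
  have hη1 : η ≠ 1 := by
    rw [hη, ne_eq, ← orderOf_dvd_iff_pow_eq_one, hχ]
    intro h
    have := Nat.le_of_dvd (by omega) h
    omega
  have hη2 : η * η = 1 := by
    rw [hη, ← pow_add,
      show (Fintype.card F - 1) / 2 + (Fintype.card F - 1) / 2 = orderOf χ by omega,
      pow_orderOf_eq_one]
  have hηm : η (-1) = -1 := by
    rw [mulChar_eq_quadraticChar hη1 (by rwa [sq]),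
      quadraticChar_neg_one_iff_not_isSquare.2 fun h => FiniteField.isSquare_neg_one_iff.1 h hq]
    simp
  have h := card_mul_ncard_dworkPoints hψ h4 hu
  rw [sum_dworkTerm_of_mod_three hq hχ _ hη hη1 hη2, dworkClassSum_one_one_one u h4 hu,
    dworkClassSum_one_quadratic hψ hF u hu hη1 hη2, hηm,
    ← gammaHypergeometricSum_quartic hF hχ (pow_ne_zero 4 hu),
    ← gammaHypergeometricSum_quadratic hF hχ (pow_ne_zero 4 hu)] at h
  apply mul_left_cancel₀ (mul_ne_zero (card_field_ne_zero (F := F)) (card_units_ne_zero (F := F)))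
  linear_combination h

theorem ncard_dworkPoints_of_mod_one (hψ : ψ ≠ 1) (hχ : orderOf χ = Fintype.card F - 1)
    {u : F} (hu : u ≠ 0) (hq : Fintype.card F % 4 = 1) :
    ((dworkPoints u).ncard : ℂ) =
      (Fintype.card F : ℂ) ^ 2 + (Fintype.card F : ℂ) + 1
        + hypergeometricSum ψ χ ![1 / 4, 2 / 4, 3 / 4] ![1, 1, 1] (u ^ 4)
        + 3 * (Fintype.card F : ℂ)
          * hypergeometricSum ψ χ ![1 / 4, 3 / 4] ![1 / 2, 1] (u ^ 4)
        + 12 * χ (-1) ^ ((Fintype.card F - 1) / 4) * (Fintype.card F : ℂ)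
          * hypergeometricSum ψ χ ![1 / 2] ![1] (u ^ 4) := by
  have hF : ringChar F ≠ 2 := ringChar_ne_two_of_odd_card (by omega)
  have h4 := four_cast_ne_zero hF
  have hc : 1 < Fintype.card F := Fintype.one_lt_card
  obtain ⟨e, he⟩ : ∃ e, Fintype.card F = 4 * e + 1 := ⟨Fintype.card F / 4, by omega⟩
  have he' : (Fintype.card F - 1) / 4 = e := by omega
  obtain ⟨ι, hι⟩ : ∃ ι, ι = χ ^ e := ⟨_, rfl⟩
  have hι2 : ι ^ 2 ≠ 1 := by
    rw [hι, ← pow_mul, ne_eq, ← orderOf_dvd_iff_pow_eq_one, hχ]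
    intro h
    have := Nat.le_of_dvd (by omega) h
    omega
  have hι4 : ι ^ 4 = 1 := by
    rw [hι, ← pow_mul, show e * 4 = orderOf χ by omega, pow_orderOf_eq_one]
  have hηm : (ι ^ 2) (-1) = 1 := by
    rw [MulChar.pow_apply' _ two_ne_zero, sq, ι.apply_neg_one_sq]
  have hιm : ι (-1) = χ (-1) ^ e := by
    rw [hι, MulChar.pow_apply_of_ne_zero _ _ (neg_ne_zero.2 one_ne_zero)]
  have ht : u ^ 4 ≠ 0 := pow_ne_zero 4 hu
  have h := card_mul_ncard_dworkPoints hψ h4 hu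
  rw [sum_dworkTerm_of_mod_one hq hχ _ (he'.symm ▸ hι) hι4, dworkClassSum_one_one_one u h4 hu,
    dworkClassSum_one_quadratic hψ hF u hu hι2 (by rw [← pow_add, hι4]), hηm,
    dworkClassSum_one_quartic hψ hF u hu hι2 hι4, hιm,
    ← hypergeometricSum_half hψ hχ he hι hι4 ht,
    ← hypergeometricSum_quarter_threeQuarters hψ hF hχ he hι hι2 hι4 ht,
    ← hypergeometricSum_quarter_half_threeQuarters hψ hF hχ he hι hι2 hι4 ht] at h
  rw [he']
  apply mul_left_cancel₀ (mul_ne_zero (card_field_ne_zero (F := F)) (card_units_ne_zero (F := F)))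
  linear_combination h

end Count

end

theorem theorem1p11 {F : Type*} [Field F] [Fintype F]
    (ψ : AddChar F ℂ) (hψ : ψ ≠ 1)
    (χ : MulChar F ℂ) (hχ : orderOf χ = Fintype.card F - 1)
    (u : F) (hu : u ≠ 0) :
    (Fintype.card F % 4 = 3 →
      ∀ (k l : ℕ) (γ : Fin k → ℤ) (γ' : Fin l → ℤ),
        GammaRepresents γ ![1 / 4, 2 / 4, 3 / 4] ![1, 1, 1] →
        (∀ j, Nat.Coprime (Fintype.card F) (γ j).natAbs) →
        GammaRepresents γ' ![1 / 4, 3 / 4] ![1 / 2, 1] →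
        (∀ j, Nat.Coprime (Fintype.card F) (γ' j).natAbs) →
        ((dworkPoints u).ncard : ℂ) =
          (Fintype.card F : ℂ) ^ 2 + (Fintype.card F : ℂ) + 1
            + gammaHypergeometricSum ψ χ γ (u ^ 4)
            - 3 * (Fintype.card F : ℂ) * gammaHypergeometricSum ψ χ γ' (u ^ 4)) ∧
    (Fintype.card F % 4 = 1 →
        ((dworkPoints u).ncard : ℂ) =
          (Fintype.card F : ℂ) ^ 2 + (Fintype.card F : ℂ) + 1
            + hypergeometricSum ψ χ ![1 / 4, 2 / 4, 3 / 4] ![1, 1, 1] (u ^ 4)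
            + 3 * (Fintype.card F : ℂ)
              * hypergeometricSum ψ χ ![1 / 4, 3 / 4] ![1 / 2, 1] (u ^ 4)
            + 12 * χ (-1) ^ ((Fintype.card F - 1) / 4) * (Fintype.card F : ℂ)
              * hypergeometricSum ψ χ ![1 / 2] ![1] (u ^ 4)) := by
  refine ⟨fun hq k l γ γ' h hc h' hc' => ?_, ncard_dworkPoints_of_mod_one hψ hχ hu⟩
  have hF : ringChar F ≠ 2 := ringChar_ne_two_of_odd_card (by omega)
  have h2 := Ring.two_ne_zero hF
  have h4 := four_cast_ne_zero hF
  have ht : u ^ 4 ≠ 0 := pow_ne_zero 4 hu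
  rw [gammaHypergeometricSum_congr hψ hχ h gammaRepresents_quarter_half_threeQuarters
      (fun j => intCast_ne_zero_of_coprime (hc j)) (by intro j; fin_cases j <;> simp [h4]) ht,
    gammaHypergeometricSum_congr hψ hχ h' gammaRepresents_quarter_threeQuarters
      (fun j => intCast_ne_zero_of_coprime (hc' j)) (by intro j; fin_cases j <;> simp [h2, h4]) ht]
  exact ncard_dworkPoints_of_mod_three hψ hχ hu hq
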